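/- Let $M$ be a compact connected smooth manifold (possibly with boundary or corners), $t_0<t_1$, $L=[t_0,t_1]\times M$, and for $i=1,2$ let $g_i=-h_i^2dt^2+\sigma_i$, where $h_i:L\to(0,\infty)$ is continuous and $\sigma_i=\sigma_i(t)$ is a continuous family of continuous Riemannian metrics on $M$, indexed by $t\in[t_0,t_1]$. The time orientation is given by $\partial_t$. Let $\tau:L\to\mathbb R$ be a differentiable time function for $g_1$ and for $g_2$, i.e. strictly increasing along future-directed causal curves. A piecewise causal curve is a piecewise smooth curve each of whose pieces is future-directed causal or past-directed causal (velocities nowhere zero); the null distance $\hat d_{\tau,g}(p,q)$ is the infimum of $\sum_i|\tau(\beta(s_i))-\tau(\beta(s_{i-1}))|$ over the piecewise causal curves $\beta$ from $p$ to $q$ with break points $s_0<\dots<s_k$. Write $\hat d_{\tau,g_1,g_2}$ for the same infimum over the larger class of curves in which each velocity is only required to be causal for $g_1$ or for $g_2$ (still future-directed throughout, or past-directed throughout, on each piece). Let $W\subset L$ be closed and non-empty, let $H>0$, and let $$Z=\big((L\times[0,H])\sqcup(L\times\{H+1\})\big)/\!\sim,\qquad (x,H)\sim(x,H+1)\ \text{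 for } x\in W.$$ Let $\mathcal C$ be the class of piecewise smooth curves $\gamma=(\alpha,h):[a,b]\to Z$, each piece of which stays in one of the sheets $L\times[0,H]$, $L\times\{H+1\}$, such that on each piece either $\alpha$ is constant, or $\alpha$ is future-directed causal, or past-directed causal, where causality of $\alpha'(s)$ is taken with respect to $g_1$ if $h(s)=0$ and with respect to $g_2$ if $h(s)\in(0,H]\cup\{H+1\}$. Put $$L_Z(\gamma)=\int_a^b |d\tau(\alpha'(s))|+|h'(s)|\,ds,\qquad d_Z(z,z')=\inf\{L_Z(\gamma):\gamma\in\mathcal C \text{ from } z \text{ to } z'\},$$ and define $\varphi_1,\varphi_2:L\to Z$ by $\varphi_1(x)=(x,0)$, and $\varphi_2(x)=(x,H)$ if $x\in W$, $\varphi_2(x)=(x,H+1)$ if $x\notin W$. Consider the comparison condition $$\frac{\sigma_2(v,v)}{h_2^2}\ \ge\ \frac{\sigma_1(v,v)}{h_1^2}\qquad\text{for all }(t,p)\in L,\ v\in T_pM.\tag{1}$$ (Under (1), $\hat d_{\tau,g_1,g_2}=\hat d_{\tau,g_1}$.) Then: (a) If $\hat d_{\tau,g_1,g_2}(x,y)>0$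 for all $x\ne y$ in $L$ (under (1): if $\hat d_{\tau,g_1}$ is definite), then $d_Z$ is a (finite) metric on $Z$ and $(Z,d_Z)$ is complete. (b) For all $(\ell,h),(\ell',h')\in L\times[0,H]$: $\ d_Z((\ell,h),(\ell',h'))\le\hat d_{\tau,g_2}(\ell,\ell')+|h-h'|$. (c) If (1) holds, then for all $(\ell,h),(\ell',h')\in L\times[0,H]$: $\ d_Z((\ell,h),(\ell',h'))\ge\hat d_{\tau,g_1}(\ell,\ell')+|h-h'|$. (d) If (1) holds and, for some $\delta>0$ with $H\ge\delta$, $\ \hat d_{\tau,g_2}(x,y)\le\hat d_{\tau,g_1}(x,y)+2\delta$ for all $x,y\in W$, then $d_Z(\varphi_1(x),\varphi_1(y))=\hat d_{\tau,g_1}(x,y)$ and $d_Z(\varphi_2(x),\varphi_2(y))=\hat d_{\tau,g_2}(x,y)$ for all $x,y\in L$. -/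

import Mathlib

open Set MeasureTheory
open scoped Manifold ContDiff ENNReal

noncomputable section

namespace NullGlue

/-- The slab `L = [t₀, t₁] × M`. When `t₀ < t₁` it carries Mathlib's product structure of a
manifold with corners, modelled on `(𝓡∂ 1).prod I`. -/
abbrev Slab (t₀ t₁ : ℝ) (M : Type*) := Set.Icc t₀ t₁ × M

section Causality

variable {E : Type*} [NormedAddCommGroup E] [NormedSpace ℝ E]
  {HM : Type*} [TopologicalSpace HM] (I : ModelWithCorners ℝ E HM)
  {M : Type*} [TopologicalSpace M] [ChartedSpace HM M]

/-- A continuous Lorentzian metric `g = -h² dt² + σ` on `[t₀, t₁] × M`: the lapse `h > 0` and, for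
each `p = (t, x)`, an inner product `σ p` on `T_x M`, both depending continuously on `(t, x)`.
Continuity of the tensor `σ` is stated for the associated quadratic form
`(t, v) ↦ σ (t, π v) (v, v)` on `[t₀, t₁] × TM` (equivalent by polarization). -/
structure SplitMetric (M : Type*) [TopologicalSpace M] [ChartedSpace HM M] [IsManifold I ∞ M]
    (t₀ t₁ : ℝ) where
  lapse : Slab t₀ t₁ M → ℝ
  lapse_pos : ∀ p, 0 < lapse p
  lapse_continuous : Continuous lapse
  spatial : ∀ p : Slab t₀ t₁ M, TangentSpace I p.2 →ₗ[ℝ] TangentSpace I p.2 →ₗ[ℝ] ℝ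
  spatial_symm : ∀ p v w, spatial p v w = spatial p w v
  spatial_pos : ∀ p v, v ≠ 0 → 0 < spatial p v v
  spatial_continuous : Continuous fun q : Set.Icc t₀ t₁ × TangentBundle I M =>
    spatial (q.1, q.2.proj) q.2.snd q.2.snd

/-- A field of sets of future-directed vectors `a ∂_t + v`, with `v ∈ T_x M`, over the slab. -/
abbrev ConeField (M : Type*) [TopologicalSpace M] [ChartedSpace HM M] (t₀ t₁ : ℝ) :=
  ∀ p : Slab t₀ t₁ M, ℝ → TangentSpace I p.2 → Prop

variable {I}

/-- The quadratic form `g (a ∂_t + v, a ∂_t + v) = -h² a² + σ (v, v)`. -/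
def SplitMetric.form [IsManifold I ∞ M] {t₀ t₁ : ℝ} (g : SplitMetric I M t₀ t₁)
    (p : Slab t₀ t₁ M) (a : ℝ) (v : TangentSpace I p.2) : ℝ :=
  -(g.lapse p) ^ 2 * a ^ 2 + g.spatial p v v

/-- The future-directed causal vectors of `g`, for the time orientation in which `∂_t` is future
directed. (A causal vector, being nonzero, has nonzero `∂_t` component.) -/
def SplitMetric.cone [IsManifold I ∞ M] {t₀ t₁ : ℝ} (g : SplitMetric I M t₀ t₁) :
    ConeField I M t₀ t₁ :=
  fun p a v => 0 < a ∧ g.form p a v ≤ 0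

/-- The vectors that are future-directed causal for `g₁` or for `g₂`. -/
def jointCone [IsManifold I ∞ M] {t₀ t₁ : ℝ} (g₁ g₂ : SplitMetric I M t₀ t₁) :
    ConeField I M t₀ t₁ :=
  fun p a v => g₁.cone p a v ∨ g₂.cone p a v

/-- The `∂_t` component of the velocity of `α : [a, b] → L` (one-sided at the end points). -/
def timeVelocity {t₀ t₁ : ℝ} (α : ℝ → Slab t₀ t₁ M) (a b s : ℝ) : ℝ :=
  derivWithin (fun u => ((α u).1 : ℝ)) (Set.Icc a b) s

variable (I) in
/-- The `TM` component of the velocity of `α : [a, b] → L` (one-sided at the end points). -/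
def spaceVelocity {t₀ t₁ : ℝ} (α : ℝ → Slab t₀ t₁ M) (a b s : ℝ) : TangentSpace I (α s).2 :=
  mfderivWithin 𝓘(ℝ, ℝ) I (fun u => (α u).2) (Set.Icc a b) s (1 : ℝ)

/-- The velocity of `α` on `[a, b]` lies at each parameter `s` in the cone field `K s`. -/
def IsFutureOn {t₀ t₁ : ℝ} (K : ℝ → ConeField I M t₀ t₁) (α : ℝ → Slab t₀ t₁ M)
    (a b : ℝ) : Prop :=
  ∀ s ∈ Set.Icc a b, K s (α s) (timeVelocity α a b s) (spaceVelocity I α a b s)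

/-- The reversed velocity of `α` on `[a, b]` lies at each parameter `s` in the cone field `K s`. -/
def IsPastOn {t₀ t₁ : ℝ} (K : ℝ → ConeField I M t₀ t₁) (α : ℝ → Slab t₀ t₁ M)
    (a b : ℝ) : Prop :=
  ∀ s ∈ Set.Icc a b, K s (α s) (-timeVelocity α a b s) (-spaceVelocity I α a b s)

variable (I) in
/-- `α` is smooth on the closed interval `[a, b]`, as a curve in the manifold `L`. -/
def IsSmoothOn {t₀ t₁ : ℝ} [Fact (t₀ < t₁)] (α : ℝ → Slab t₀ t₁ M) (a b : ℝ) : Prop :=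
  ContMDiffOn 𝓘(ℝ, ℝ) ((𝓡∂ 1).prod I) ∞ α (Set.Icc a b)

/-- `τ` is a time function for the causal structure `C`: it is continuous and strictly increasing
along every future-directed causal curve. -/
def IsTimeFunction {t₀ t₁ : ℝ} [Fact (t₀ < t₁)] (C : ConeField I M t₀ t₁)
    (τ : Slab t₀ t₁ M → ℝ) : Prop :=
  Continuous τ ∧ ∀ (β : ℝ → Slab t₀ t₁ M) (a b : ℝ), a < b → IsSmoothOn I β a b →
    IsFutureOn (fun _ => C) β a b → StrictMonoOn (fun s => τ (β s)) (Set.Icc a b)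

/-- `β : [s 0, s k] → L` is a piecewise causal curve with break points `s 0 < s 1 < ⋯ < s k`: on
each piece it is smooth and either future-directed causal or past-directed causal. -/
def IsPiecewiseCausal {t₀ t₁ : ℝ} [Fact (t₀ < t₁)] (C : ConeField I M t₀ t₁)
    (β : ℝ → Slab t₀ t₁ M) (k : ℕ) (s : ℕ → ℝ) : Prop :=
  ∀ i < k, s i < s (i + 1) ∧ IsSmoothOn I β (s i) (s (i + 1)) ∧
    (IsFutureOn (fun _ => C) β (s i) (s (i + 1)) ∨ IsPastOn (fun _ => C) β (s i) (s (i + 1)))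

/-- The null length `∑ᵢ |τ (β (s (i + 1))) - τ (β (s i))|`. -/
def nullLength {t₀ t₁ : ℝ} (τ : Slab t₀ t₁ M → ℝ) (β : ℝ → Slab t₀ t₁ M) (k : ℕ)
    (s : ℕ → ℝ) : ℝ≥0∞ :=
  ENNReal.ofReal (∑ i ∈ Finset.range k, |τ (β (s (i + 1))) - τ (β (s i))|)

/-- The null distance of `p` and `q`: the infimum of the null lengths of the piecewise causal
curves from `p` to `q` (`∞` if there is none). -/
def nullDist {t₀ t₁ : ℝ} [Fact (t₀ < t₁)] (C : ConeField I M t₀ t₁) (τ : Slab t₀ t₁ M → ℝ)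
    (p q : Slab t₀ t₁ M) : ℝ≥0∞ :=
  ⨅ (β : ℝ → Slab t₀ t₁ M) (k : ℕ) (s : ℕ → ℝ) (_ : IsPiecewiseCausal C β k s)
    (_ : β (s 0) = p) (_ : β (s k) = q), nullLength τ β k s

end Causality

section Gluing

variable {M : Type*} {t₀ t₁ : ℝ}

/-- The gluing relation on `(L × [0, H]) ⊔ L`, the second summand standing for `L × {H + 1}`:
`(x, H)` is related to `(x, H + 1)` for `x ∈ W`. -/
def GlueRel (H : ℝ) (W : Set (Slab t₀ t₁ M)) (a b : (Slab t₀ t₁ M × Set.Icc 0 H) ⊕ Slab t₀ t₁ M) :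
    Prop :=
  ∃ x ∈ W, ∃ y : Set.Icc 0 H, (y : ℝ) = H ∧ a = Sum.inl (x, y) ∧ b = Sum.inr x

/-- The glued space `Z`, the quotient of `(L × [0, H]) ⊔ (L × {H + 1})` by the equivalence relation
generated by the gluing relation. -/
def Glued (H : ℝ) (W : Set (Slab t₀ t₁ M)) : Type _ := Quot (GlueRel H W)

variable {H : ℝ} {W : Set (Slab t₀ t₁ M)}

/-- The point `(x, h)` of `Z`, for `h ∈ [0, H]`. -/
def Glued.lower (W : Set (Slab t₀ t₁ M)) (x : Slab t₀ t₁ M) (h : Set.Icc 0 H) : Glued H W :=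
  Quot.mk _ (Sum.inl (x, h))

/-- The point `(x, H + 1)` of `Z`. -/
def Glued.upper (H : ℝ) (W : Set (Slab t₀ t₁ M)) (x : Slab t₀ t₁ M) : Glued H W :=
  Quot.mk _ (Sum.inr x)

/-- The projection of `Z` to `L`. -/
def Glued.base : Glued H W → Slab t₀ t₁ M :=
  Quot.lift (Sum.elim Prod.fst id) (by rintro _ _ ⟨x, _, y, _, rfl, rfl⟩; rfl)

/-- The height function on `Z`, with the sheet `L × {H + 1}` put at height `H` to make it well
defined. Along a curve that stays in one sheet it differs from the coordinate `h` by a constant,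
so it has the same derivative. -/
def Glued.height : Glued H W → ℝ :=
  Quot.lift (Sum.elim (fun y => (y.2 : ℝ)) (fun _ => H))
    (by rintro _ _ ⟨x, _, y, hy, rfl, rfl⟩; exact hy)

/-- `φ₁ x = (x, 0)`. -/
def Glued.phi₁ (hH : 0 ≤ H) (W : Set (Slab t₀ t₁ M)) (x : Slab t₀ t₁ M) : Glued H W :=
  Glued.lower W x ⟨0, le_refl 0, hH⟩

open Classical in
/-- `φ₂ x = (x, H + 1)` for `x ∉ W` and `φ₂ x = (x, H)` for `x ∈ W`. -/
def Glued.phi₂ (hH : 0 ≤ H) (W : Set (Slab t₀ t₁ M)) (x : Slab t₀ t₁ M) : Glued H W :=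
  if x ∈ W then Glued.lower W x ⟨H, hH, le_refl H⟩ else Glued.upper H W x

end Gluing

section GluedDistance

variable {E : Type*} [NormedAddCommGroup E] [NormedSpace ℝ E]
  {HM : Type*} [TopologicalSpace HM] {I : ModelWithCorners ℝ E HM}
  {M : Type*} [TopologicalSpace M] [ChartedSpace HM M] [IsManifold I ∞ M]
  {t₀ t₁ : ℝ} {H : ℝ} {W : Set (Slab t₀ t₁ M)}

open Classical in
/-- The causal structure in force at a point of `Z`: that of `g₁` at height `0`, and that of `g₂` on
`L × (0, H]` and on `L × {H + 1}`. -/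
def coneAt (g₁ g₂ : SplitMetric I M t₀ t₁) (z : Glued H W) : ConeField I M t₀ t₁ :=
  if z.height = 0 then g₁.cone else g₂.cone

/-- One piece `γ : [a, b] → Z` of a curve of the class `𝒞`. It stays in one of the two sheets
`L × [0, H]` and `L × {H + 1}`, its components in `L` and in the height are smooth, and the
`L`-component is future-directed causal, or past-directed causal, for the causal structure in force
at `γ s`, or it is constant (vertical motion). -/
def IsMixedPiece [Fact (t₀ < t₁)] (g₁ g₂ : SplitMetric I M t₀ t₁) (γ : ℝ → Glued H W)
    (a b : ℝ) : Prop :=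
  ((∀ s ∈ Set.Icc a b, ∃ x h, γ s = Glued.lower W x h) ∨
      (∀ s ∈ Set.Icc a b, ∃ x, γ s = Glued.upper H W x)) ∧
    IsSmoothOn I (fun s => (γ s).base) a b ∧
    ContDiffOn ℝ ∞ (fun s => (γ s).height) (Set.Icc a b) ∧
    (IsFutureOn (fun s => coneAt g₁ g₂ (γ s)) (fun s => (γ s).base) a b ∨
      IsPastOn (fun s => coneAt g₁ g₂ (γ s)) (fun s => (γ s).base) a b ∨
      ∀ s ∈ Set.Icc a b, (γ s).base = (γ a).base)

/-- `γ : [s 0, s k] → Z` belongs to the class `𝒞`, with break points `s 0 < s 1 < ⋯ < s k`. -/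
def IsMixedCurve [Fact (t₀ < t₁)] (g₁ g₂ : SplitMetric I M t₀ t₁) (γ : ℝ → Glued H W)
    (k : ℕ) (s : ℕ → ℝ) : Prop :=
  ∀ i < k, s i < s (i + 1) ∧ IsMixedPiece g₁ g₂ γ (s i) (s (i + 1))

/-- The length `∫ |dτ (α')| + |h'|` over `[a, b]` of the curve `γ = (α, h)`, where
`dτ (α') = (τ ∘ α)'`. -/
def mixedLength (τ : Slab t₀ t₁ M → ℝ) (γ : ℝ → Glued H W) (a b : ℝ) : ℝ≥0∞ :=
  ∫⁻ u in Set.Icc a b, ENNReal.ofReal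
    (|deriv (fun r => τ (γ r).base) u| + |deriv (fun r => (γ r).height) u|)

/-- The distance `d_Z`: the infimum of the lengths of the curves of the class `𝒞` from `z` to `z'`
(`∞` if there is none). -/
def gluedDist [Fact (t₀ < t₁)] (g₁ g₂ : SplitMetric I M t₀ t₁) (τ : Slab t₀ t₁ M → ℝ)
    (z z' : Glued H W) : ℝ≥0∞ :=
  ⨅ (γ : ℝ → Glued H W) (k : ℕ) (s : ℕ → ℝ) (_ : IsMixedCurve g₁ g₂ γ k s)
    (_ : γ (s 0) = z) (_ : γ (s k) = z'), mixedLength τ γ (s 0) (s k)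

end GluedDistance

end NullGlue

end

/-! Since `τ` increases along causal curves and is differentiable, its differential is nonnegative
on every future causal vector of either metric (`exists_hasDerivAt_of_cone`). Hence on a causal
piece the integral of `|dτ(α')|` is the jump of `τ`, even if the piece switches between the two
cones (`lintegral_deriv_of_causal`), and the length in `Z` is null length plus variation of height.

Upper bounds come from explicit curves: causal curves lifted to a constant height, and vertical
segments. Lower bounds come from one principle (`le_add_chainDist`): if `F` grows along each piece
by at most the length of the piece, then `F z' ≤ F z + d(z, z')`. Every lower bound is a choice of
`F`.

For (c) and `φ₁`, the cones of `g₂` lie in those of `g₁`, so base and height give a suitable `F`.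
For `φ₂` the danger is a shortcut: leave the upper sheet through `W`, descend to height 0, travel
more cheaply with `g₁`, and return. This costs `2H` in height and saves at most `2δ ≤ 2H` between
points of `W`; `nullDist_snd_le_gluedDist_upper` encodes this balance in `F`.

For (a), base and height separate all points except the two copies, at heights `H` and `H + 1`, of a
point outside `W`. A curve joining these crosses `W`, which is compact and hence at positive null
distance from that point. The null distance is small near the diagonal (`eventually_nullDist_le`).
Connectedness then makes it finite, and `Z` is a union of two continuous images of compact spaces,
hence compact and complete. -/

noncomputable section

namespace NullGlue

/-! ### Length distances defined by concatenating pieces. -/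

section Chains

/-- A class of curve pieces in `X`, each with a length, which depend only on the restriction of the
curve to the parameter interval and are invariant under translation and reversal of the
parameter. -/
structure PieceClass (X : Type*) where
  IsPiece : (ℝ → X) → ℝ → ℝ → Prop
  len : (ℝ → X) → ℝ → ℝ → ℝ≥0∞
  congr : ∀ {γ γ' : ℝ → X} {a b : ℝ}, a < b → EqOn γ γ' (Icc a b) → IsPiece γ a b →
    IsPiece γ' a b ∧ len γ' a b = len γ a b
  shift : ∀ {γ : ℝ → X} {a b : ℝ} (c : ℝ), a < b → IsPiece γ a b →
    IsPiece (fun u => γ (u + c)) (a - c) (b - c) ∧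
      len (fun u => γ (u + c)) (a - c) (b - c) = len γ a b
  reverse : ∀ {γ : ℝ → X} {a b : ℝ}, a < b → IsPiece γ a b →
    IsPiece (fun u => γ (-u)) (-b) (-a) ∧ len (fun u => γ (-u)) (-b) (-a) = len γ a b

namespace PieceClass

variable {X : Type*} (P : PieceClass X)

/-- A curve made of `k` consecutive pieces of the class `P`. -/
def IsChain (γ : ℝ → X) (k : ℕ) (s : ℕ → ℝ) : Prop :=
  ∀ i < k, s i < s (i + 1) ∧ P.IsPiece γ (s i) (s (i + 1))

/-- The infimum of the lengths of the chains from `p` to `q`. -/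
def chainDist (p q : X) : ℝ≥0∞ :=
  ⨅ (γ : ℝ → X) (k : ℕ) (s : ℕ → ℝ) (_ : P.IsChain γ k s) (_ : γ (s 0) = p) (_ : γ (s k) = q),
    ∑ i ∈ Finset.range k, P.len γ (s i) (s (i + 1))

variable {P}

theorem chainDist_le {γ : ℝ → X} {k : ℕ} {s : ℕ → ℝ} (h : P.IsChain γ k s) :
    P.chainDist (γ (s 0)) (γ (s k)) ≤ ∑ i ∈ Finset.range k, P.len γ (s i) (s (i + 1)) :=
  iInf_le_of_le γ <| iInf_le_of_le k <| iInf_le_of_le s <| iInf_le_of_le h <|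
    iInf_le_of_le rfl <| iInf_le_of_le rfl le_rfl

theorem le_chainDist {p q : X} {c : ℝ≥0∞} (h : ∀ (γ : ℝ → X) (k : ℕ) (s : ℕ → ℝ),
    P.IsChain γ k s → γ (s 0) = p → γ (s k) = q →
      c ≤ ∑ i ∈ Finset.range k, P.len γ (s i) (s (i + 1))) : c ≤ P.chainDist p q :=
  le_iInf fun γ => le_iInf fun k => le_iInf fun s => le_iInf fun h₁ => le_iInf fun h₂ =>
    le_iInf fun h₃ => h γ k s h₁ h₂ h₃

theorem exists_chain_of_lt {p q : X} {c : ℝ≥0∞} (h : P.chainDist p q < c) :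
    ∃ (γ : ℝ → X) (k : ℕ) (s : ℕ → ℝ), P.IsChain γ k s ∧ γ (s 0) = p ∧ γ (s k) = q ∧
      ∑ i ∈ Finset.range k, P.len γ (s i) (s (i + 1)) < c := by
  simp only [chainDist, iInf_lt_iff] at h
  obtain ⟨γ, k, s, h₁, h₂, h₃, h₄⟩ := h
  exact ⟨γ, k, s, h₁, h₂, h₃, h₄⟩

theorem chainDist_self (p : X) : P.chainDist p p = 0 := by
  have h : P.IsChain (fun _ => p) 0 (fun _ => 0) := fun i hi => absurd hi (Nat.not_lt_zero i)
  simpa using chainDist_le h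

theorem chainDist_le_len {γ : ℝ → X} {a b : ℝ} (hab : a < b) (h : P.IsPiece γ a b) :
    P.chainDist (γ a) (γ b) ≤ P.len γ a b := by
  have h' : P.IsChain γ 1 (fun i => if i = 0 then a else b) := by
    intro i hi
    obtain rfl : i = 0 := by omega
    simpa using ⟨hab, h⟩
  simpa using chainDist_le h'

theorem IsChain.mono {γ : ℝ → X} {k : ℕ} {s : ℕ → ℝ} (h : P.IsChain γ k s) {i j : ℕ}
    (hij : i ≤ j) (hj : j ≤ k) : s i ≤ s j := by
  induction j, hij using Nat.le_induction with
  | base => exact le_rfl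
  | succ j hij ih => exact (ih (by omega)).trans (h j (by omega)).1.le

/-- Induction along a nearly minimal chain. This is the source of all lower bounds for distances,
and also of comparisons between two distances, with `F` the distance to be bounded from above. -/
theorem le_add_chainDist {F : X → ℝ≥0∞}
    (hF : ∀ (γ : ℝ → X) (a b : ℝ), a < b → P.IsPiece γ a b → F (γ b) ≤ F (γ a) + P.len γ a b)
    (p q : X) : F q ≤ F p + P.chainDist p q := by
  refine ENNReal.le_of_forall_pos_le_add fun ε hε hfin => ?_
  have hd : P.chainDist p q ≠ ⊤ := fun h => by simp [h] at hfin
  obtain ⟨γ, k, s, hc, rfl, rfl, hl⟩ := exists_chain_of_lt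
    (ENNReal.lt_add_right hd (by simpa using hε.ne' : (ε : ℝ≥0∞) ≠ 0))
  have key : ∀ j ≤ k, F (γ (s j)) ≤
      F (γ (s 0)) + ∑ i ∈ Finset.range j, P.len γ (s i) (s (i + 1)) := by
    intro j
    induction j with
    | zero => simp
    | succ j ih =>
      intro hj
      rw [Finset.sum_range_succ, ← add_assoc]
      exact (hF γ _ _ (hc j (by omega)).1 (hc j (by omega)).2).trans
        (add_le_add_left (ih (by omega)) _)
  calc F (γ (s k)) ≤ _ := key k le_rfl
    _ ≤ F (γ (s 0)) + (P.chainDist (γ (s 0)) (γ (s k)) + ε) := by gcongr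
    _ = _ := by rw [add_assoc]

theorem chainDist_comm_le (p q : X) : P.chainDist q p ≤ P.chainDist p q := by
  refine le_chainDist fun γ k s hc hp hq => ?_
  have hc' : P.IsChain (fun u => γ (-u)) k (fun i => -s (k - i)) := by
    intro i hi
    have e : k - i = k - (i + 1) + 1 := by omega
    have := hc (k - (i + 1)) (by omega)
    simp only [e]
    exact ⟨neg_lt_neg this.1, (P.reverse this.1 this.2).1⟩
  have h := chainDist_le hc'
  simp only [neg_neg, Nat.sub_zero, Nat.sub_self, hp, hq] at h
  refine h.trans (le_of_eq ?_)
  rw [← Finset.sum_range_reflect]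
  refine Finset.sum_congr rfl fun i hi => ?_
  rw [Finset.mem_range] at hi
  have e₁ : k - (k - 1 - i) = i + 1 := by omega
  have e₂ : k - (k - 1 - i + 1) = i := by omega
  rw [e₁, e₂]
  exact (P.reverse (hc i hi).1 (hc i hi).2).2

theorem chainDist_comm (p q : X) : P.chainDist p q = P.chainDist q p :=
  le_antisymm (chainDist_comm_le q p) (chainDist_comm_le p q)

theorem chainDist_triangle (p q r : X) :
    P.chainDist p r ≤ P.chainDist p q + P.chainDist q r := by
  refine ENNReal.le_of_forall_pos_le_add fun ε hε hfin => ?_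
  rw [ENNReal.add_lt_top] at hfin
  have hε' : ((ε / 2 : NNReal) : ℝ≥0∞) ≠ 0 := by simpa using hε.ne'
  obtain ⟨γ₁, k₁, s₁, hc₁, hp, hq, hl₁⟩ := exists_chain_of_lt (ENNReal.lt_add_right hfin.1.ne hε')
  obtain ⟨γ₂, k₂, s₂, hc₂, hq', hr, hl₂⟩ := exists_chain_of_lt (ENNReal.lt_add_right hfin.2.ne hε')
  -- Translation by `c` makes the second chain start at the parameter where the first one ends.
  obtain ⟨c, hc⟩ : ∃ c, c = s₂ 0 - s₁ k₁ := ⟨_, rfl⟩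
  obtain ⟨γ, hγ⟩ : ∃ γ : ℝ → X, γ = fun u => if u ≤ s₁ k₁ then γ₁ u else γ₂ (u + c) := ⟨_, rfl⟩
  obtain ⟨s, hs⟩ : ∃ s : ℕ → ℝ, s = fun i => if i ≤ k₁ then s₁ i else s₂ (i - k₁) - c := ⟨_, rfl⟩
  have hs₁ : ∀ i ≤ k₁, s i = s₁ i := fun i hi => by simp [hs, hi]
  have hs₂ : ∀ i, s (k₁ + i) = s₂ i - c := by
    intro i
    rcases Nat.eq_zero_or_pos i with rfl | hi
    · simp [hs, hc]
    · simp [hs, hi.ne']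
  have hγ₁ : ∀ u ≤ s₁ k₁, γ₁ u = γ u := fun u hu => by simp [hγ, hu]
  -- At the junction `γ` is defined by `γ₁`, but both curves pass through `q` there.
  have hγ₂ : ∀ u, s₁ k₁ ≤ u → γ₂ (u + c) = γ u := by
    intro u hu
    rcases hu.eq_or_lt with rfl | hu
    · simp [hγ, hc, hq, hq']
    · simp [hγ, not_le.2 hu]
  have h₁ : ∀ i < k₁, s i < s (i + 1) ∧ P.IsPiece γ (s i) (s (i + 1)) ∧
      P.len γ (s i) (s (i + 1)) = P.len γ₁ (s₁ i) (s₁ (i + 1)) := by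
    intro i hi
    rw [hs₁ i hi.le, hs₁ (i + 1) hi]
    exact ⟨(hc₁ i hi).1, P.congr (hc₁ i hi).1
      (fun u hu => hγ₁ u (hu.2.trans (hc₁.mono hi le_rfl))) (hc₁ i hi).2⟩
  have h₂ : ∀ i < k₂, s (k₁ + i) < s (k₁ + i + 1) ∧ P.IsPiece γ (s (k₁ + i)) (s (k₁ + i + 1)) ∧
      P.len γ (s (k₁ + i)) (s (k₁ + i + 1)) = P.len γ₂ (s₂ i) (s₂ (i + 1)) := by
    intro i hi
    rw [add_assoc, hs₂, hs₂]
    have hlt := sub_lt_sub_right (hc₂ i hi).1 c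
    have hsh := P.shift c (hc₂ i hi).1 (hc₂ i hi).2
    have := P.congr hlt (fun u hu => hγ₂ u ?_) hsh.1
    · exact ⟨hlt, this.1, this.2.trans hsh.2⟩
    · have := hc₂.mono (Nat.zero_le i) hi.le
      have := hu.1
      linarith
  have hchain : P.IsChain γ (k₁ + k₂) s := by
    intro i hi
    rcases lt_or_ge i k₁ with h | h
    · exact ⟨(h₁ i h).1, (h₁ i h).2.1⟩
    · obtain ⟨j, rfl⟩ := Nat.exists_eq_add_of_le h
      have hj : j < k₂ := by omega
      exact ⟨(h₂ j hj).1, (h₂ j hj).2.1⟩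
  have h := chainDist_le hchain
  have e₀ : γ (s 0) = p := by
    rw [hs₁ 0 (Nat.zero_le _), ← hγ₁ _ (hc₁.mono (Nat.zero_le _) le_rfl), hp]
  have e₁ : γ (s (k₁ + k₂)) = r := by
    rw [hs₂, ← hγ₂, sub_add_cancel, hr]
    have := hc₂.mono (Nat.zero_le k₂) le_rfl
    linarith
  rw [e₀, e₁, Finset.sum_range_add,
    Finset.sum_congr rfl fun i hi => (h₁ i (Finset.mem_range.1 hi)).2.2,
    Finset.sum_congr rfl fun i hi => (h₂ i (Finset.mem_range.1 hi)).2.2] at h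
  refine h.trans ((add_le_add hl₁.le hl₂.le).trans (le_of_eq ?_))
  rw [add_add_add_comm, ← ENNReal.coe_add, add_halves]

end PieceClass

end Chains

/-! ### Smooth causal curves under restriction, translation and reversal. -/

section Curves

theorem timeVelocity_congr {M : Type*} {t₀ t₁ : ℝ} {α α' : ℝ → Slab t₀ t₁ M} {a b s : ℝ}
    (he : EqOn α α' (Icc a b)) (hs : s ∈ Icc a b) : timeVelocity α' a b s = timeVelocity α a b s :=
  derivWithin_congr (fun u hu => by rw [he hu]) (by rw [he hs])

variable {E : Type*} [NormedAddCommGroup E] [NormedSpace ℝ E]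
  {HM : Type*} [TopologicalSpace HM] {I : ModelWithCorners ℝ E HM}
  {M : Type*} [TopologicalSpace M] [ChartedSpace HM M] {t₀ t₁ : ℝ}

/-- All tangent spaces unfold to `E`; taking `v : E` moves a vector between equal base points
without a cast. -/
theorem cone_congr_point (C : ConeField I M t₀ t₁) {p q : Slab t₀ t₁ M} (h : p = q) (a : ℝ)
    (v : E) : C p a v ↔ C q a v := by
  subst h; rfl

theorem uniqueMDiffWithinAt_Icc {a b s : ℝ} (hab : a < b) (hs : s ∈ Icc a b) :
    UniqueMDiffWithinAt 𝓘(ℝ, ℝ) (Icc a b) s :=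
  (uniqueDiffOn_Icc hab s hs).uniqueMDiffWithinAt

section Smooth

variable [Fact (t₀ < t₁)]

/-- Smoothness into the manifold with boundary `[t₀, t₁]` is smoothness of the real coordinate,
because `projIcc` is smooth on the interval and inverts the inclusion. -/
theorem isSmoothOn_iff {α : ℝ → Slab t₀ t₁ M} {a b : ℝ} :
    IsSmoothOn I α a b ↔ ContDiffOn ℝ ∞ (fun u => ((α u).1 : ℝ)) (Icc a b) ∧
      ContMDiffOn 𝓘(ℝ, ℝ) I ∞ (fun u => (α u).2) (Icc a b) := by
  constructor
  · intro h
    refine ⟨contMDiffOn_iff_contDiffOn.1 ?_, contMDiff_snd.comp_contMDiffOn h⟩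
    exact contMDiff_subtypeVal_Icc.comp_contMDiffOn (contMDiff_fst.comp_contMDiffOn h)
  · rintro ⟨h₁, h₂⟩
    have h₃ : ContMDiffOn 𝓘(ℝ, ℝ) (𝓡∂ 1) ∞
        (projIcc t₀ t₁ (Fact.out : t₀ < t₁).le ∘ fun u => ((α u).1 : ℝ)) (Icc a b) :=
      contMDiffOn_projIcc.comp (contMDiffOn_iff_contDiffOn.2 h₁) fun u _ => (α u).1.2
    exact (h₃.prodMk h₂).congr fun u _ =>
      Prod.ext (projIcc_val (Fact.out : t₀ < t₁).le (α u).1).symm rfl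

theorem IsSmoothOn.comp {α : ℝ → Slab t₀ t₁ M} {a b a' b' : ℝ} {φ : ℝ → ℝ}
    (h : IsSmoothOn I α a b) (hφ : ContDiff ℝ ∞ φ) (hm : MapsTo φ (Icc a' b') (Icc a b)) :
    IsSmoothOn I (fun u => α (φ u)) a' b' :=
  ContMDiffOn.comp h (contMDiff_iff_contDiff.2 hφ).contMDiffOn hm

theorem IsSmoothOn.congr {α α' : ℝ → Slab t₀ t₁ M} {a b : ℝ} (h : IsSmoothOn I α a b)
    (he : EqOn α α' (Icc a b)) : IsSmoothOn I α' a b :=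
  ContMDiffOn.congr h fun _ hu => (he hu).symm

theorem IsSmoothOn.continuousOn {α : ℝ → Slab t₀ t₁ M} {a b : ℝ} (h : IsSmoothOn I α a b) :
    ContinuousOn α (Icc a b) :=
  ContMDiffOn.continuousOn h

theorem timeVelocity_comp {α : ℝ → Slab t₀ t₁ M} {a b a' b' e u : ℝ} {φ : ℝ → ℝ}
    (h : IsSmoothOn I α a b) (hφ : HasDerivWithinAt φ e (Icc a' b') u)
    (hm : MapsTo φ (Icc a' b') (Icc a b)) (hab : a' < b') (hu : u ∈ Icc a' b') :
    timeVelocity (fun u => α (φ u)) a' b' u = e * timeVelocity α a b (φ u) := by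
  have h₁ := ((isSmoothOn_iff.1 h).1.differentiableOn (by simp) (φ u) (hm hu)).hasDerivWithinAt
  exact (h₁.scomp u hφ hm).derivWithin (uniqueDiffOn_Icc hab u hu)

theorem spaceVelocity_comp {α : ℝ → Slab t₀ t₁ M} {a b a' b' e u : ℝ} {φ : ℝ → ℝ}
    (h : IsSmoothOn I α a b) (hφ : HasDerivWithinAt φ e (Icc a' b') u)
    (hm : MapsTo φ (Icc a' b') (Icc a b)) (hab : a' < b') (hu : u ∈ Icc a' b') :
    spaceVelocity I (fun u => α (φ u)) a' b' u = e • spaceVelocity I α a b (φ u) := by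
  have h₁ := ((isSmoothOn_iff.1 h).2.mdifferentiableOn (by simp) (φ u) (hm hu)).hasMFDerivWithinAt
  have h₂ := h₁.comp u (hasMFDerivWithinAt_iff_hasFDerivWithinAt.2 hφ.hasFDerivWithinAt) hm
  have h₃ := h₂.mfderivWithin (uniqueMDiffWithinAt_Icc hab hu)
  have h₄ := congrArg (fun L : ℝ →L[ℝ] E => L 1) h₃
  refine h₄.trans ?_
  change mfderivWithin 𝓘(ℝ, ℝ) I (fun u => (α u).2) (Icc a b) (φ u) ((1 : ℝ) • e) = _
  rw [one_smul, spaceVelocity]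
  conv_lhs => rw [show e = e • (1 : ℝ) by simp]
  exact map_smul _ _ _

theorem IsFutureOn.comp {K : ℝ → ConeField I M t₀ t₁} {α : ℝ → Slab t₀ t₁ M} {a b a' b' : ℝ}
    {φ : ℝ → ℝ} (hf : IsFutureOn K α a b) (h : IsSmoothOn I α a b) (hφ : ∀ u, HasDerivAt φ 1 u)
    (hm : MapsTo φ (Icc a' b') (Icc a b)) (hab : a' < b') :
    IsFutureOn (fun u => K (φ u)) (fun u => α (φ u)) a' b' := by
  intro u hu
  rw [timeVelocity_comp h (hφ u).hasDerivWithinAt hm hab hu,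
    spaceVelocity_comp h (hφ u).hasDerivWithinAt hm hab hu, one_mul, one_smul]
  exact hf _ (hm hu)

theorem IsPastOn.comp {K : ℝ → ConeField I M t₀ t₁} {α : ℝ → Slab t₀ t₁ M} {a b a' b' : ℝ}
    {φ : ℝ → ℝ} (hf : IsPastOn K α a b) (h : IsSmoothOn I α a b) (hφ : ∀ u, HasDerivAt φ 1 u)
    (hm : MapsTo φ (Icc a' b') (Icc a b)) (hab : a' < b') :
    IsPastOn (fun u => K (φ u)) (fun u => α (φ u)) a' b' := by
  intro u hu
  rw [timeVelocity_comp h (hφ u).hasDerivWithinAt hm hab hu,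
    spaceVelocity_comp h (hφ u).hasDerivWithinAt hm hab hu, one_mul, one_smul]
  exact hf _ (hm hu)

theorem mapsTo_neg_Icc (a b : ℝ) : MapsTo Neg.neg (Icc (-b) (-a)) (Icc a b) :=
  fun _ hu => ⟨by linarith [hu.2], by linarith [hu.1]⟩

theorem mapsTo_add_Icc (a b c : ℝ) : MapsTo (· + c) (Icc (a - c) (b - c)) (Icc a b) :=
  fun _ hu => ⟨by linarith [hu.1], by linarith [hu.2]⟩

theorem IsFutureOn.reverse {K : ℝ → ConeField I M t₀ t₁} {α : ℝ → Slab t₀ t₁ M} {a b : ℝ}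
    (hf : IsFutureOn K α a b) (h : IsSmoothOn I α a b) (hab : a < b) :
    IsPastOn (fun u => K (-u)) (fun u => α (-u)) (-b) (-a) := by
  intro u hu
  have hd := (hasDerivAt_neg u).hasDerivWithinAt (s := Icc (-b) (-a))
  rw [timeVelocity_comp h hd (mapsTo_neg_Icc a b) (neg_lt_neg hab) hu,
    spaceVelocity_comp h hd (mapsTo_neg_Icc a b) (neg_lt_neg hab) hu, neg_one_mul, neg_neg,
    neg_one_smul, neg_neg]
  exact hf _ (mapsTo_neg_Icc a b hu)

theorem IsPastOn.reverse {K : ℝ → ConeField I M t₀ t₁} {α : ℝ → Slab t₀ t₁ M} {a b : ℝ}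
    (hf : IsPastOn K α a b) (h : IsSmoothOn I α a b) (hab : a < b) :
    IsFutureOn (fun u => K (-u)) (fun u => α (-u)) (-b) (-a) := by
  intro u hu
  have hd := (hasDerivAt_neg u).hasDerivWithinAt (s := Icc (-b) (-a))
  rw [timeVelocity_comp h hd (mapsTo_neg_Icc a b) (neg_lt_neg hab) hu,
    spaceVelocity_comp h hd (mapsTo_neg_Icc a b) (neg_lt_neg hab) hu, neg_one_mul,
    neg_one_smul]
  exact hf _ (mapsTo_neg_Icc a b hu)

end Smooth

theorem spaceVelocity_congr {α α' : ℝ → Slab t₀ t₁ M} {a b s : ℝ} (he : EqOn α α' (Icc a b))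
    (hs : s ∈ Icc a b) : (spaceVelocity I α' a b s : E) = (spaceVelocity I α a b s : E) :=
  congrArg (fun L : ℝ →L[ℝ] E => L 1) (mfderivWithin_congr (I := 𝓘(ℝ, ℝ)) (I' := I)
    (f := fun u => (α u).2) (f₁ := fun u => (α' u).2) (fun u hu => by rw [he hu]) (by rw [he hs]))

theorem IsFutureOn.congr {K K' : ℝ → ConeField I M t₀ t₁} {α α' : ℝ → Slab t₀ t₁ M} {a b : ℝ}
    (hf : IsFutureOn K α a b) (hK : EqOn K K' (Icc a b)) (he : EqOn α α' (Icc a b)) :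
    IsFutureOn K' α' a b := by
  intro s hs
  have h := hf s hs
  rw [hK hs, ← timeVelocity_congr he hs] at h
  have h₂ := (cone_congr_point (K' s) (he hs) _ (spaceVelocity I α a b s : E)).1 h
  rwa [← spaceVelocity_congr he hs] at h₂

theorem IsPastOn.congr {K K' : ℝ → ConeField I M t₀ t₁} {α α' : ℝ → Slab t₀ t₁ M} {a b : ℝ}
    (hf : IsPastOn K α a b) (hK : EqOn K K' (Icc a b)) (he : EqOn α α' (Icc a b)) :
    IsPastOn K' α' a b := by
  intro s hs
  have h := hf s hs
  rw [hK hs, ← timeVelocity_congr he hs] at h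
  have h₂ := (cone_congr_point (K' s) (he hs) _ (-spaceVelocity I α a b s : E)).1 h
  rwa [← spaceVelocity_congr he hs] at h₂

theorem IsFutureOn.mono {K K' : ℝ → ConeField I M t₀ t₁} {α : ℝ → Slab t₀ t₁ M} {a b : ℝ}
    (hf : IsFutureOn K α a b) (hK : ∀ s ∈ Icc a b, ∀ p r v, K s p r v → K' s p r v) :
    IsFutureOn K' α a b :=
  fun s hs => hK s hs _ _ _ (hf s hs)

theorem IsPastOn.mono {K K' : ℝ → ConeField I M t₀ t₁} {α : ℝ → Slab t₀ t₁ M} {a b : ℝ}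
    (hf : IsPastOn K α a b) (hK : ∀ s ∈ Icc a b, ∀ p r v, K s p r v → K' s p r v) :
    IsPastOn K' α a b :=
  fun s hs => hK s hs _ _ _ (hf s hs)

/-- The pieces of piecewise causal curves, with their null lengths. -/
def causalPieces [Fact (t₀ < t₁)] (C : ConeField I M t₀ t₁) (τ : Slab t₀ t₁ M → ℝ) :
    PieceClass (Slab t₀ t₁ M) where
  IsPiece β a b := IsSmoothOn I β a b ∧
    (IsFutureOn (fun _ => C) β a b ∨ IsPastOn (fun _ => C) β a b)
  len β a b := ENNReal.ofReal |τ (β b) - τ (β a)|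
  congr {γ γ' a b} hab he h :=
    ⟨⟨h.1.congr he, h.2.imp (fun h => h.congr (fun _ _ => rfl) he)
      (fun h => h.congr (fun _ _ => rfl) he)⟩,
      by rw [he (left_mem_Icc.2 hab.le), he (right_mem_Icc.2 hab.le)]⟩
  shift {γ a b} c hab h := by
    have hd : ∀ u, HasDerivAt (fun u : ℝ => u + c) 1 u := fun u => (hasDerivAt_id u).add_const c
    refine ⟨⟨h.1.comp (by fun_prop) (mapsTo_add_Icc a b c), ?_⟩, by simp⟩
    exact h.2.imp (fun hf => hf.comp h.1 hd (mapsTo_add_Icc a b c) (sub_lt_sub_right hab c))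
      (fun hf => hf.comp h.1 hd (mapsTo_add_Icc a b c) (sub_lt_sub_right hab c))
  reverse {γ a b} hab h := by
    refine ⟨⟨h.1.comp contDiff_neg (mapsTo_neg_Icc a b), ?_⟩, by simp [abs_sub_comm]⟩
    exact h.2.symm.imp (fun hf => hf.reverse h.1 hab) (fun hf => hf.reverse h.1 hab)

theorem nullDist_eq_chainDist [Fact (t₀ < t₁)] (C : ConeField I M t₀ t₁) (τ : Slab t₀ t₁ M → ℝ)
    (p q : Slab t₀ t₁ M) : nullDist C τ p q = (causalPieces C τ).chainDist p q := by
  simp only [nullDist, PieceClass.chainDist, nullLength]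
  congr! 9
  exact ENNReal.ofReal_sum_of_nonneg fun _ _ => abs_nonneg _

end Curves

/-! ### The length in the glued space as a sum over pieces. -/

section Mixed

variable {E : Type*} [NormedAddCommGroup E] [NormedSpace ℝ E]
  {HM : Type*} [TopologicalSpace HM] {I : ModelWithCorners ℝ E HM}
  {M : Type*} [TopologicalSpace M] [ChartedSpace HM M]
  {t₀ t₁ : ℝ} {H : ℝ} {W : Set (Slab t₀ t₁ M)}

/-- The integral `∫ |f'| + |g'|` over `[a, b]`. -/
def variationIntegral (f g : ℝ → ℝ) (a b : ℝ) : ℝ≥0∞ :=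
  ∫⁻ u in Icc a b, ENNReal.ofReal (|deriv f u| + |deriv g u|)

/-- `deriv` at an end point sees the functions outside the interval, but the end points form a null
set. -/
theorem variationIntegral_congr {f f' g g' : ℝ → ℝ} {a b : ℝ} (hf : EqOn f f' (Icc a b))
    (hg : EqOn g g' (Icc a b)) : variationIntegral f' g' a b = variationIntegral f g a b := by
  have hder : ∀ {k k' : ℝ → ℝ}, EqOn k k' (Icc a b) → ∀ u ∈ Ioo a b, deriv k' u = deriv k u := by
    intro k k' hk u hu
    refine Filter.EventuallyEq.deriv_eq ?_
    filter_upwards [isOpen_Ioo.mem_nhds hu] with r hr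
    exact (hk (Ioo_subset_Icc_self hr)).symm
  rw [variationIntegral, variationIntegral, ← setLIntegral_congr Ioo_ae_eq_Icc,
    ← setLIntegral_congr Ioo_ae_eq_Icc]
  exact setLIntegral_congr_fun measurableSet_Ioo fun u hu => by
    simp only [hder hf u hu, hder hg u hu]

theorem variationIntegral_shift (f g : ℝ → ℝ) (a b c : ℝ) :
    variationIntegral (fun u => f (u + c)) (fun u => g (u + c)) (a - c) (b - c) =
      variationIntegral f g a b := by
  have h := (measurePreserving_add_right volume c).setLIntegral_comp_preimage_emb
    (measurableEmbedding_addRight c) (fun u => ENNReal.ofReal (|deriv f u| + |deriv g u|))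
    (Icc a b)
  simpa only [variationIntegral, deriv_comp_add_const, preimage_add_const_Icc] using h

theorem variationIntegral_reverse (f g : ℝ → ℝ) (a b : ℝ) :
    variationIntegral (fun u => f (-u)) (fun u => g (-u)) (-b) (-a) =
      variationIntegral f g a b := by
  have h := (Measure.measurePreserving_neg (volume : Measure ℝ)).setLIntegral_comp_preimage_emb
    (MeasurableEquiv.neg ℝ).measurableEmbedding
    (fun u => ENNReal.ofReal (|deriv f u| + |deriv g u|)) (Icc a b)
  have e : (Neg.neg ⁻¹' Icc a b : Set ℝ) = Icc (-b) (-a) := by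
    ext u; simp only [mem_preimage, mem_Icc, neg_le, le_neg]; tauto
  rw [e] at h
  simpa only [variationIntegral, deriv_comp_neg, abs_neg] using h

theorem variationIntegral_add (f g : ℝ → ℝ) {a b c : ℝ} (hab : a ≤ b) (hbc : b ≤ c) :
    variationIntegral f g a c = variationIntegral f g a b + variationIntegral f g b c := by
  rw [variationIntegral, variationIntegral, variationIntegral,
    ← setLIntegral_congr (Ioc_ae_eq_Icc (a := a) (b := c)),
    ← setLIntegral_congr (Ioc_ae_eq_Icc (a := a) (b := b)),
    ← setLIntegral_congr (Ioc_ae_eq_Icc (a := b) (b := c)), ← Ioc_union_Ioc_eq_Ioc hab hbc,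
    lintegral_union measurableSet_Ioc (Ioc_disjoint_Ioc_of_le le_rfl)]

variable [IsManifold I ∞ M] [Fact (t₀ < t₁)]

/-- The pieces of the curves of the class `𝒞`, with their lengths. -/
def mixedPieces (g₁ g₂ : SplitMetric I M t₀ t₁) (τ : Slab t₀ t₁ M → ℝ) :
    PieceClass (Glued H W) where
  IsPiece γ a b := IsMixedPiece g₁ g₂ γ a b
  len γ a b := mixedLength τ γ a b
  congr {γ γ' a b} hab he h := by
    have hb : EqOn (fun s => (γ s).base) (fun s => (γ' s).base) (Icc a b) :=
      fun u hu => by simp only [he hu]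
    have hh : EqOn (fun s => (γ s).height) (fun s => (γ' s).height) (Icc a b) :=
      fun u hu => by simp only [he hu]
    have hK : EqOn (fun s => coneAt g₁ g₂ (γ s)) (fun s => coneAt g₁ g₂ (γ' s)) (Icc a b) :=
      fun u hu => by simp only [he hu]
    refine ⟨⟨h.1.imp (fun h s hs => he hs ▸ h s hs) (fun h s hs => he hs ▸ h s hs), h.2.1.congr hb,
      h.2.2.1.congr fun u hu => (hh hu).symm, ?_⟩,
      variationIntegral_congr (fun u hu => by simp only [he hu]) hh⟩
    refine h.2.2.2.imp (fun h => h.congr hK hb) (Or.imp (fun h => h.congr hK hb) fun h s hs => ?_)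
    rw [← he hs, ← he (left_mem_Icc.2 hab.le), h s hs]
  shift {γ a b} c hab h := by
    have hd : ∀ u, HasDerivAt (fun u : ℝ => u + c) 1 u := fun u => (hasDerivAt_id u).add_const c
    have hm := mapsTo_add_Icc a b c
    have hlt := sub_lt_sub_right hab c
    refine ⟨⟨h.1.imp (fun h s hs => h _ (hm hs)) (fun h s hs => h _ (hm hs)),
      h.2.1.comp (by fun_prop) hm, h.2.2.1.comp (by fun_prop) hm, ?_⟩,
      variationIntegral_shift (fun r => τ (γ r).base) (fun r => (γ r).height) a b c⟩
    refine h.2.2.2.imp (fun hf => hf.comp h.2.1 hd hm hlt)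
      (Or.imp (fun hf => hf.comp h.2.1 hd hm hlt) fun h s hs => ?_)
    simp only [h _ (hm hs), sub_add_cancel]
  reverse {γ a b} hab h := by
    have hm := mapsTo_neg_Icc a b
    refine ⟨⟨h.1.imp (fun h s hs => h _ (hm hs)) (fun h s hs => h _ (hm hs)),
      h.2.1.comp contDiff_neg hm, h.2.2.1.comp (by fun_prop) hm, ?_⟩,
      variationIntegral_reverse (fun r => τ (γ r).base) (fun r => (γ r).height) a b⟩
    rcases h.2.2.2 with hf | hf | hf
    · exact Or.inr (Or.inl (hf.reverse h.2.1 hab))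
    · exact Or.inl (hf.reverse h.2.1 hab)
    · refine Or.inr (Or.inr fun s hs => ?_)
      rw [hf _ (hm hs), hf _ (hm (left_mem_Icc.2 (neg_lt_neg hab).le))]

theorem mixedLength_eq_sum {g₁ g₂ : SplitMetric I M t₀ t₁} {τ : Slab t₀ t₁ M → ℝ}
    {γ : ℝ → Glued H W} {k : ℕ} {s : ℕ → ℝ} (h : IsMixedCurve g₁ g₂ γ k s) :
    mixedLength τ γ (s 0) (s k) =
      ∑ i ∈ Finset.range k, mixedLength τ γ (s i) (s (i + 1)) := by
  have hmono : ∀ j ≤ k, s 0 ≤ s j := by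
    intro j
    induction j with
    | zero => simp
    | succ j ih => exact fun hj => (ih (by omega)).trans (h j (by omega)).1.le
  suffices ∀ j ≤ k, mixedLength τ γ (s 0) (s j) =
      ∑ i ∈ Finset.range j, mixedLength τ γ (s i) (s (i + 1)) from this k le_rfl
  intro j
  induction j with
  | zero => simp [mixedLength]
  | succ j ih =>
    intro hj
    rw [Finset.sum_range_succ, ← ih (by omega)]
    exact variationIntegral_add _ _ (hmono j (by omega)) (h j (by omega)).1.le

theorem gluedDist_eq_chainDist (g₁ g₂ : SplitMetric I M t₀ t₁) (τ : Slab t₀ t₁ M → ℝ)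
    (z z' : Glued H W) : gluedDist g₁ g₂ τ z z' = (mixedPieces g₁ g₂ τ).chainDist z z' := by
  simp only [gluedDist, PieceClass.chainDist]
  refine iInf_congr fun γ => iInf_congr fun k => iInf_congr fun s => iInf_congr fun h => ?_
  rw [mixedLength_eq_sum h]
  rfl

end Mixed

/-! ### Total variation as the integral of the absolute derivative. -/

section Variation

theorem measurable_ofReal_abs_deriv (f : ℝ → ℝ) :
    Measurable fun u => ENNReal.ofReal |deriv f u| :=
  (continuous_abs.measurable.comp (measurable_deriv f)).ennreal_ofReal

theorem variationIntegral_eq_add (f g : ℝ → ℝ) (a b : ℝ) :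
    variationIntegral f g a b = (∫⁻ u in Icc a b, ENNReal.ofReal |deriv f u|) +
      ∫⁻ u in Icc a b, ENNReal.ofReal |deriv g u| := by
  rw [← lintegral_add_left (measurable_ofReal_abs_deriv f)]
  simp only [variationIntegral, ENNReal.ofReal_add (abs_nonneg _) (abs_nonneg _)]

/-- If the integral is infinite there is nothing to show; otherwise the derivative is integrable and
the fundamental theorem of calculus applies. -/
theorem ofReal_abs_sub_le_lintegral {f : ℝ → ℝ} {a b c d : ℝ} (hf : ContinuousOn f (Icc a b))
    (hd : ∀ s ∈ Ioo a b, DifferentiableAt ℝ f s) (hac : a ≤ c) (hcd : c ≤ d) (hdb : d ≤ b) :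
    ENNReal.ofReal |f d - f c| ≤ ∫⁻ u in Icc a b, ENNReal.ofReal |deriv f u| := by
  have hsub : Ioc c d ⊆ Icc a b := fun u hu => ⟨hac.trans hu.1.le, hu.2.trans hdb⟩
  refine le_trans ?_ (lintegral_mono_set hsub)
  by_cases hfin : ∫⁻ u in Ioc c d, ENNReal.ofReal |deriv f u| = ⊤
  · simp [hfin]
  have hint : IntervalIntegrable (deriv f) volume c d := by
    rw [intervalIntegrable_iff_integrableOn_Ioc_of_le hcd]
    refine ⟨(measurable_deriv f).aestronglyMeasurable, ?_⟩
    simpa only [HasFiniteIntegral, Real.enorm_eq_ofReal_abs] using lt_top_iff_ne_top.2 hfin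
  have h := intervalIntegral.integral_eq_sub_of_hasDerivAt_of_le hcd
    (hf.mono fun u hu => ⟨hac.trans hu.1, hu.2.trans hdb⟩)
    (fun x hx => (hd x ⟨hac.trans_lt hx.1, hx.2.trans_le hdb⟩).hasDerivAt) hint
  rw [← h, intervalIntegral.integral_of_le hcd, ← Real.enorm_eq_ofReal_abs]
  refine (enorm_integral_le_lintegral_enorm _).trans (le_of_eq ?_)
  simp only [Real.enorm_eq_ofReal_abs]

/-- Meant for `τ` along a causal curve, where the derivative need not be continuous. Its sign makes
it integrable. -/
theorem lintegral_deriv_of_nonneg {f : ℝ → ℝ} {a b : ℝ} (hab : a ≤ b)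
    (hf : ContinuousOn f (Icc a b)) (hd : ∀ s ∈ Ioo a b, ∃ d, 0 ≤ d ∧ HasDerivAt f d s) :
    ∫⁻ u in Icc a b, ENNReal.ofReal |deriv f u| = ENNReal.ofReal |f b - f a| := by
  have hd₁ : ∀ s ∈ Ioo a b, HasDerivAt f (deriv f s) s := fun s hs => by
    obtain ⟨d, _, h⟩ := hd s hs
    exact h.differentiableAt.hasDerivAt
  have hd₂ : ∀ s ∈ Ioo a b, 0 ≤ deriv f s := fun s hs => by
    obtain ⟨d, h₀, h⟩ := hd s hs
    rwa [h.deriv]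
  have hint := intervalIntegral.integrableOn_deriv_of_nonneg hf hd₁ hd₂
  have h := intervalIntegral.integral_eq_sub_of_hasDerivAt_of_le hab hf hd₁
    ((intervalIntegrable_iff_integrableOn_Ioc_of_le hab).2 hint)
  rw [intervalIntegral.integral_of_le hab, integral_Ioc_eq_integral_Ioo] at h
  have hnn : 0 ≤ᵐ[volume.restrict (Ioo a b)] deriv f :=
    (ae_restrict_iff' measurableSet_Ioo).2 (Filter.Eventually.of_forall hd₂)
  have hnn' : 0 ≤ f b - f a := by rw [← h]; exact integral_nonneg_of_ae hnn
  rw [abs_of_nonneg hnn', ← h, ofReal_integral_eq_lintegral_ofReal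
    (hint.mono_set Ioo_subset_Ioc_self) hnn, ← setLIntegral_congr Ioo_ae_eq_Icc]
  exact setLIntegral_congr_fun measurableSet_Ioo fun u hu => by
    simp only [abs_of_nonneg (hd₂ u hu)]

theorem lintegral_deriv_of_nonpos {f : ℝ → ℝ} {a b : ℝ} (hab : a ≤ b)
    (hf : ContinuousOn f (Icc a b)) (hd : ∀ s ∈ Ioo a b, ∃ d ≤ 0, HasDerivAt f d s) :
    ∫⁻ u in Icc a b, ENNReal.ofReal |deriv f u| = ENNReal.ofReal |f b - f a| := by
  have h := lintegral_deriv_of_nonneg hab hf.neg fun s hs => by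
    obtain ⟨d, h₀, h⟩ := hd s hs
    exact ⟨-d, neg_nonneg.2 h₀, h.neg⟩
  have e : |(-f) b - (-f) a| = |f b - f a| := by
    rw [Pi.neg_apply, Pi.neg_apply, neg_sub_neg, abs_sub_comm]
  rw [e] at h
  rw [← h]
  refine lintegral_congr fun u => ?_
  have : deriv (-f) u = -deriv f u := by simp
  rw [this, abs_neg]

end Variation

/-! ### The differential of a time function on causal vectors. -/

section TimeFunction

/-- The curve with affine time component `u ↦ r + w * (u - s)`, cut off at the ends of
`[t₀, t₁]`, over a curve `c` in `M`. -/
def affineLift {M : Type*} (t₀ t₁ : ℝ) [Fact (t₀ < t₁)] (r w s : ℝ) (c : ℝ → M) :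
    ℝ → Slab t₀ t₁ M :=
  fun u => (projIcc t₀ t₁ (Fact.out : t₀ < t₁).le (r + w * (u - s)), c u)

theorem coe_affineLift_fst {M : Type*} {t₀ t₁ : ℝ} [Fact (t₀ < t₁)] {r w s u : ℝ}
    {c : ℝ → M} (h : r + w * (u - s) ∈ Icc t₀ t₁) :
    ((affineLift t₀ t₁ r w s c u).1 : ℝ) = r + w * (u - s) := by
  simp [affineLift, projIcc_of_mem _ h]

theorem timeVelocity_affineLift {M : Type*} {t₀ t₁ : ℝ} [Fact (t₀ < t₁)] {r w s a b u : ℝ}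
    {c : ℝ → M} (hab : a < b)
    (h : ∀ u ∈ Icc a b, r + w * (u - s) ∈ Icc t₀ t₁) (hu : u ∈ Icc a b) :
    timeVelocity (affineLift t₀ t₁ r w s c) a b u = w := by
  have hd : HasDerivWithinAt (fun u => r + w * (u - s)) w (Icc a b) u := by
    simpa using ((((hasDerivAt_id u).sub_const s).const_mul w).const_add r).hasDerivWithinAt
  rw [timeVelocity, derivWithin_congr (f := fun u => r + w * (u - s))
    (fun u hu => coe_affineLift_fst (h u hu)) (coe_affineLift_fst (h u hu))]
  exact hd.derivWithin (uniqueDiffOn_Icc hab u hu)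

/-- A time component equal to `t₀` or `t₁` at an interior parameter would be a local extremum. The
strict inclusion leaves room to perturb the curve in time. -/
theorem fst_mem_Ioo_of_timeVelocity_ne_zero {M : Type*} {t₀ t₁ : ℝ} {α : ℝ → Slab t₀ t₁ M}
    {a b s : ℝ} (hs : s ∈ Ioo a b) (hv : timeVelocity α a b s ≠ 0) : ((α s).1 : ℝ) ∈ Ioo t₀ t₁ := by
  have hnhds : Icc a b ∈ nhds s := Icc_mem_nhds hs.1 hs.2
  rw [timeVelocity, derivWithin_of_mem_nhds hnhds] at hv
  refine ⟨(α s).1.2.1.lt_of_ne fun he => hv ?_, (α s).1.2.2.lt_of_ne fun he => hv ?_⟩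
  · refine IsLocalMin.deriv_eq_zero (Filter.Eventually.of_forall fun u => ?_)
    simpa [← he] using (α u).1.2.1
  · refine IsLocalMax.deriv_eq_zero (Filter.Eventually.of_forall fun u => ?_)
    simpa [he] using (α u).1.2.2

variable {E : Type*} [NormedAddCommGroup E] [NormedSpace ℝ E]
  {HM : Type*} [TopologicalSpace HM] {I : ModelWithCorners ℝ E HM}
  {M : Type*} [TopologicalSpace M] [ChartedSpace HM M]
  {t₀ t₁ : ℝ}

theorem continuous_form [IsManifold I ∞ M] (g : SplitMetric I M t₀ t₁) :
    Continuous fun q : Icc t₀ t₁ × ℝ × TangentBundle I M =>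
      g.form (q.1, q.2.2.proj) q.2.1 q.2.2.snd := by
  have h₁ : Continuous fun q : Icc t₀ t₁ × ℝ × TangentBundle I M => (q.1, q.2.2) := by fun_prop
  have h₂ : Continuous fun q : Icc t₀ t₁ × ℝ × TangentBundle I M => g.lapse (q.1, q.2.2.proj) :=
    g.lapse_continuous.comp (continuous_fst.prodMk
      ((FiberBundle.continuous_proj E (TangentSpace I)).comp (by fun_prop)))
  exact ((h₂.pow 2).neg.mul (by fun_prop)).add (g.spatial_continuous.comp h₁)

variable [Fact (t₀ < t₁)]

theorem isSmoothOn_affineLift {r w s a b : ℝ} {c : ℝ → M}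
    (hc : ContMDiffOn 𝓘(ℝ, ℝ) I ∞ c (Icc a b))
    (h : ∀ u ∈ Icc a b, r + w * (u - s) ∈ Icc t₀ t₁) :
    IsSmoothOn I (affineLift t₀ t₁ r w s c) a b := by
  refine isSmoothOn_iff.2 ⟨ContDiffOn.congr ?_ fun u hu => coe_affineLift_fst (h u hu), hc⟩
  fun_prop

variable [IsManifold I ∞ M]

theorem continuousOn_velocity {c : ℝ → M} {a b : ℝ} (hab : a < b)
    (hc : ContMDiffOn 𝓘(ℝ, ℝ) I ∞ c (Icc a b)) :
    ContinuousOn (fun u => (⟨c u, mfderivWithin 𝓘(ℝ, ℝ) I c (Icc a b) u (1 : ℝ)⟩ :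
      TangentBundle I M)) (Icc a b) := by
  have : IsManifold I 1 M := .of_le (n := ∞) (by simp)
  have h := hc.continuousOn_tangentMapWithin (by simp) (uniqueDiffOn_Icc hab).uniqueMDiffOn
  have h₁ : Continuous fun u : ℝ => (⟨u, (1 : ℝ)⟩ : TangentBundle 𝓘(ℝ, ℝ) ℝ) :=
    (tangentBundleModelSpaceHomeomorph 𝓘(ℝ, ℝ)).symm.continuous.comp
      (continuous_id.prodMk continuous_const)
  exact h.comp h₁.continuousOn fun u hu => hu

/-- Being strictly timelike is an open condition, so the lift is a causal curve near `s` and the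
definition of a time function applies to it. -/
theorem strictMonoOn_affineLift {g : SplitMetric I M t₀ t₁} {τ : Slab t₀ t₁ M → ℝ}
    (hτ : IsTimeFunction g.cone τ) {c : ℝ → M} {a b s r w : ℝ}
    (hc : ContMDiffOn 𝓘(ℝ, ℝ) I ∞ c (Icc a b)) (hs : s ∈ Ioo a b) (hr : r ∈ Ioo t₀ t₁)
    (hw : 0 < w) (hg : g.form (projIcc t₀ t₁ (Fact.out : t₀ < t₁).le r, c s) w
      (mfderivWithin 𝓘(ℝ, ℝ) I c (Icc a b) s (1 : ℝ)) < 0) :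
    ∃ ε > 0, StrictMonoOn (fun u => τ (affineLift t₀ t₁ r w s c u)) (Icc (s - ε) (s + ε)) := by
  have hab : a < b := hs.1.trans hs.2
  have hnhds : Icc a b ∈ nhds s := Icc_mem_nhds hs.1 hs.2
  have hcont : ContinuousAt (fun u => g.form (affineLift t₀ t₁ r w s c u) w
      (mfderivWithin 𝓘(ℝ, ℝ) I c (Icc a b) u (1 : ℝ))) s := by
    have h₁ : ContinuousAt (fun u =>
        projIcc t₀ t₁ (Fact.out : t₀ < t₁).le (r + w * (u - s))) s :=
      (continuous_projIcc.comp (by fun_prop)).continuousAt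
    have h₂ := ((continuousOn_velocity hab hc) s (Ioo_subset_Icc_self hs)).continuousAt hnhds
    have h₃ := h₁.prodMk ((continuousAt_const (y := w)).prodMk h₂)
    have h₄ := ContinuousAt.comp (x := s) (continuous_form g).continuousAt h₃
    exact h₄
  have hneg : ∀ᶠ u in nhds s, g.form (affineLift t₀ t₁ r w s c u) w
      (mfderivWithin 𝓘(ℝ, ℝ) I c (Icc a b) u (1 : ℝ)) < 0 := by
    refine hcont.eventually_lt continuousAt_const ?_
    have e : ∀ r', r' = r → g.form (projIcc t₀ t₁ (Fact.out : t₀ < t₁).le r', c s) w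
        (mfderivWithin 𝓘(ℝ, ℝ) I c (Icc a b) s (1 : ℝ)) < 0 := by
      rintro _ rfl
      exact hg
    exact e _ (by simp)
  have hIoo : ∀ᶠ u in nhds s, r + w * (u - s) ∈ Ioo t₀ t₁ := by
    have : ContinuousAt (fun u => r + w * (u - s)) s := by fun_prop
    exact this.eventually (isOpen_Ioo.mem_nhds (by simpa using hr))
  obtain ⟨ε, hε, hball⟩ := Metric.nhds_basis_closedBall.eventually_iff.1
    ((hneg.and hIoo).and hnhds)
  rw [Real.closedBall_eq_Icc] at hball
  refine ⟨ε, hε, ?_⟩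
  have hlt : s - ε < s + ε := by linarith
  have hsub : Icc (s - ε) (s + ε) ⊆ Icc a b := fun u hu => (hball hu).2
  have hmem : ∀ u ∈ Icc (s - ε) (s + ε), r + w * (u - s) ∈ Icc t₀ t₁ :=
    fun u hu => Ioo_subset_Icc_self (hball hu).1.2
  refine hτ.2 _ _ _ hlt (isSmoothOn_affineLift (hc.mono hsub) hmem) fun u hu => ?_
  rw [timeVelocity_affineLift hlt hmem hu]
  refine ⟨hw, ?_⟩
  have e : spaceVelocity I (affineLift t₀ t₁ r w s c) (s - ε) (s + ε) u =
      mfderivWithin 𝓘(ℝ, ℝ) I c (Icc a b) u (1 : ℝ) :=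
    congrArg (fun L : ℝ →L[ℝ] E => L 1)
      ((hc.mdifferentiableOn (by simp) u (hsub hu)).mfderivWithin_mono
        (uniqueMDiffWithinAt_Icc hlt hu) hsub)
  rw [e]
  exact (hball hu).1.1.le

/-- A curve in the joint cone may switch metric at any parameter, so monotonicity of `τ` along it is
not given. The sign is obtained pointwise, from a curve through the same point that is timelike for
a single metric. -/
theorem exists_hasDerivAt_of_cone {g₁ g₂ : SplitMetric I M t₀ t₁} {τ : Slab t₀ t₁ M → ℝ}
    (hτ : MDifferentiable ((𝓡∂ 1).prod I) 𝓘(ℝ, ℝ) τ)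
    (hτ₁ : IsTimeFunction g₁.cone τ) (hτ₂ : IsTimeFunction g₂.cone τ)
    {α : ℝ → Slab t₀ t₁ M} {a b s : ℝ} (h : IsSmoothOn I α a b) (hs : s ∈ Ioo a b)
    (hC : jointCone g₁ g₂ (α s) (timeVelocity α a b s) (spaceVelocity I α a b s)) :
    ∃ d, 0 ≤ d ∧ HasDerivAt (fun u => τ (α u)) d s := by
  wlog h₁ : g₁.cone (α s) (timeVelocity α a b s) (spaceVelocity I α a b s) generalizing g₁ g₂
  · exact this hτ₂ hτ₁ hC.symm (hC.resolve_left h₁)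
  have hle := (Fact.out : t₀ < t₁).le
  have hab : a < b := hs.1.trans hs.2
  have hnhds : Icc a b ∈ nhds s := Icc_mem_nhds hs.1 hs.2
  have hIoo := fst_mem_Ioo_of_timeVelocity_ne_zero hs h₁.1.ne'
  obtain ⟨c, hc_def⟩ : ∃ c : ℝ → M, c = fun u => (α u).2 := ⟨_, rfl⟩
  have hc : ContMDiffOn 𝓘(ℝ, ℝ) I ∞ c (Icc a b) := hc_def ▸ (isSmoothOn_iff.1 h).2
  -- `G` is `τ` on the surface over the spatial curve `c`. The given curve and its perturbations in
  -- time are graphs in this surface, so one linear map computes all the derivatives.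
  obtain ⟨G, hG_def⟩ : ∃ G : ℝ × ℝ → ℝ, G = fun p => τ (projIcc t₀ t₁ hle p.1, c p.2) := ⟨_, rfl⟩
  obtain ⟨r, hr⟩ : ∃ r : ℝ, r = (α s).1 := ⟨_, rfl⟩
  have hG : DifferentiableAt ℝ G (r, s) := by
    rw [← mdifferentiableAt_iff_differentiableAt, hG_def]
    have hp : MDifferentiableAt 𝓘(ℝ, ℝ) (𝓡∂ 1) (projIcc t₀ t₁ hle) r :=
      (contMDiffOn_projIcc (n := 1)).contMDiffAt
        (Icc_mem_nhds (hr ▸ hIoo.1) (hr ▸ hIoo.2)) |>.mdifferentiableAt (by simp)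
    have hc' : MDifferentiableAt 𝓘(ℝ, ℝ) I c s :=
      (hc.contMDiffAt hnhds).mdifferentiableAt (by simp)
    have hf : MDifferentiableAt 𝓘(ℝ, ℝ × ℝ) 𝓘(ℝ, ℝ) (Prod.fst : ℝ × ℝ → ℝ) (r, s) :=
      differentiableAt_fst.mdifferentiableAt
    have hs' : MDifferentiableAt 𝓘(ℝ, ℝ × ℝ) 𝓘(ℝ, ℝ) (Prod.snd : ℝ × ℝ → ℝ) (r, s) :=
      differentiableAt_snd.mdifferentiableAt
    have h₂ := (hp.comp (r, s) (f := Prod.fst) hf).prodMk (hc'.comp (r, s) (f := Prod.snd) hs')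
    exact (hτ _).comp (r, s) h₂
  have hcurve : ∀ {k : ℝ → ℝ} {k' : ℝ}, HasDerivAt k k' s → k s = r →
      HasDerivAt (fun u => G (k u, u)) (fderiv ℝ G (r, s) (k', 1)) s := by
    intro k k' hk hks
    have hfd : HasFDerivAt G (fderiv ℝ G (r, s)) (k s, s) := hks ▸ hG.hasFDerivAt
    exact HasFDerivAt.comp_hasDerivAt (f := fun u => (k u, u)) s hfd (hk.prodMk (hasDerivAt_id s))
  have hv : HasDerivAt (fun u => ((α u).1 : ℝ)) (timeVelocity α a b s) s := by
    rw [timeVelocity, derivWithin_of_mem_nhds hnhds]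
    exact (((isSmoothOn_iff.1 h).1.contDiffAt hnhds).differentiableAt (by simp)).hasDerivAt
  have hτα : (fun u => τ (α u)) = fun u => G ((α u).1, u) := by
    funext u
    simp only [hG_def, projIcc_val, hc_def]
  refine ⟨fderiv ℝ G (r, s) (timeVelocity α a b s, 1), ?_, by
    rw [hτα]; exact hcurve hv hr.symm⟩
  have hpt : α s = (projIcc t₀ t₁ hle r, c s) := by
    simp only [hr, projIcc_val, hc_def]
  have hcone := (cone_congr_point g₁.cone hpt _ (spaceVelocity I α a b s : E)).1 h₁
  -- Adding `ε ∂_t` to a causal vector makes it strictly timelike; the limit `ε → 0` then gives the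
  -- sign on the vector itself.
  have key : ∀ ε > 0, 0 ≤ fderiv ℝ G (r, s) (timeVelocity α a b s, 1) +
      ε * fderiv ℝ G (r, s) (1, 0) := by
    intro ε hε
    have hform : g₁.form (projIcc t₀ t₁ hle r, c s) (timeVelocity α a b s + ε)
        (spaceVelocity I α a b s : E) < 0 := by
      refine lt_of_lt_of_le ?_ hcone.2
      have hl := pow_pos (g₁.lapse_pos (projIcc t₀ t₁ hle r, c s)) 2
      have h0 := hcone.1
      simp only [SplitMetric.form]
      nlinarith [mul_pos hl (mul_pos hε h0), mul_pos hl (mul_pos hε hε)]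
    have hform' : g₁.form (projIcc t₀ t₁ hle r, c s) (timeVelocity α a b s + ε)
        (mfderivWithin 𝓘(ℝ, ℝ) I c (Icc a b) s (1 : ℝ) : E) < 0 := by
      subst hc_def; exact hform
    obtain ⟨η, hη, hmono⟩ := strictMonoOn_affineLift hτ₁ hc hs (hr ▸ hIoo)
      (add_pos hcone.1 hε) hform'
    have hd : HasDerivAt (fun u => τ (affineLift t₀ t₁ r (timeVelocity α a b s + ε) s c u))
        (fderiv ℝ G (r, s) (timeVelocity α a b s + ε, 1)) s := by
      have hk : HasDerivAt (fun u => r + (timeVelocity α a b s + ε) * (u - s))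
          (timeVelocity α a b s + ε) s := by
        simpa using ((((hasDerivAt_id s).sub_const s).const_mul
          (timeVelocity α a b s + ε)).const_add r)
      have := hcurve hk (by simp)
      rw [hG_def] at this ⊢
      exact this
    have hnn : 0 ≤ fderiv ℝ G (r, s) (timeVelocity α a b s + ε, 1) := by
      have hd' := hd.hasDerivWithinAt (s := Icc (s - η) (s + η))
      have hmem : s ∈ Icc (s - η) (s + η) := ⟨by linarith, by linarith⟩
      rw [← hd'.derivWithin (uniqueDiffOn_Icc (by linarith) s hmem)]
      exact hmono.monotoneOn.derivWithin_nonneg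
    have e : ((timeVelocity α a b s + ε, 1) : ℝ × ℝ) =
        (timeVelocity α a b s, 1) + ε • ((1, 0) : ℝ × ℝ) := by simp
    rwa [e, map_add, map_smul, smul_eq_mul] at hnn
  have hlim : Filter.Tendsto (fun ε => fderiv ℝ G (r, s) (timeVelocity α a b s, 1) +
      ε * fderiv ℝ G (r, s) (1, 0)) (nhdsWithin 0 (Ioi 0))
      (nhds (fderiv ℝ G (r, s) (timeVelocity α a b s, 1))) := by
    have hct : Continuous fun ε => fderiv ℝ G (r, s) (timeVelocity α a b s, 1) +
      ε * fderiv ℝ G (r, s) (1, 0) := by fun_prop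
    simpa using (hct.tendsto 0).mono_left nhdsWithin_le_nhds
  exact ge_of_tendsto hlim (Filter.eventually_of_mem self_mem_nhdsWithin fun ε hε => key ε hε)

end TimeFunction

/-! ### Formal properties of the null distance. -/

section NullDist

variable {E : Type*} [NormedAddCommGroup E] [NormedSpace ℝ E]
  {HM : Type*} [TopologicalSpace HM] {I : ModelWithCorners ℝ E HM}
  {M : Type*} [TopologicalSpace M] [ChartedSpace HM M]
  {t₀ t₁ : ℝ} [Fact (t₀ < t₁)] {C : ConeField I M t₀ t₁} {τ : Slab t₀ t₁ M → ℝ}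

theorem nullDist_self (p : Slab t₀ t₁ M) : nullDist C τ p p = 0 := by
  rw [nullDist_eq_chainDist, PieceClass.chainDist_self]

theorem nullDist_comm (p q : Slab t₀ t₁ M) : nullDist C τ p q = nullDist C τ q p := by
  simp only [nullDist_eq_chainDist, PieceClass.chainDist_comm p q]

theorem nullDist_triangle (p q r : Slab t₀ t₁ M) :
    nullDist C τ p r ≤ nullDist C τ p q + nullDist C τ q r := by
  simp only [nullDist_eq_chainDist]
  exact PieceClass.chainDist_triangle p q r

theorem nullDist_le_of_causal {β : ℝ → Slab t₀ t₁ M} {a b : ℝ} (hab : a < b)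
    (hs : IsSmoothOn I β a b) (hc : IsFutureOn (fun _ => C) β a b ∨ IsPastOn (fun _ => C) β a b) :
    nullDist C τ (β a) (β b) ≤ ENNReal.ofReal |τ (β b) - τ (β a)| := by
  rw [nullDist_eq_chainDist]
  exact PieceClass.chainDist_le_len (P := causalPieces C τ) hab ⟨hs, hc⟩

theorem le_add_nullDist {F : Slab t₀ t₁ M → ℝ≥0∞}
    (hF : ∀ (β : ℝ → Slab t₀ t₁ M) (a b : ℝ), a < b → IsSmoothOn I β a b →
      (IsFutureOn (fun _ => C) β a b ∨ IsPastOn (fun _ => C) β a b) →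
      F (β b) ≤ F (β a) + ENNReal.ofReal |τ (β b) - τ (β a)|)
    (p q : Slab t₀ t₁ M) : F q ≤ F p + nullDist C τ p q := by
  rw [nullDist_eq_chainDist]
  exact PieceClass.le_add_chainDist (P := causalPieces C τ)
    (fun β a b hab h => hF β a b hab h.1 h.2) p q

theorem nullDist_anti {C' : ConeField I M t₀ t₁} (h : ∀ p r v, C p r v → C' p r v)
    (p q : Slab t₀ t₁ M) : nullDist C' τ p q ≤ nullDist C τ p q := by
  have := le_add_nullDist (C := C) (τ := τ) (F := fun q => nullDist C' τ p q)
    (fun β a b hab hs hc => (nullDist_triangle _ (β a) _).trans (add_le_add_right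
      (nullDist_le_of_causal hab hs (hc.imp (fun hf => hf.mono fun _ _ => h)
        fun hf => hf.mono fun _ _ => h)) _)) p q
  simpa only [nullDist_self, zero_add] using this

end NullDist

/-! ### Length of causal curves; continuity and finiteness of the null distance. -/

section Causal

variable {E : Type*} [NormedAddCommGroup E] [NormedSpace ℝ E]
  {HM : Type*} [TopologicalSpace HM] {I : ModelWithCorners ℝ E HM}
  {M : Type*} [TopologicalSpace M] [ChartedSpace HM M] [IsManifold I ∞ M]
  {t₀ t₁ : ℝ}

theorem form_neg (g : SplitMetric I M t₀ t₁) (p : Slab t₀ t₁ M) (a : ℝ)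
    (v : TangentSpace I p.2) : g.form p (-a) (-v) = g.form p a v := by
  simp [SplitMetric.form]

theorem form_zero_neg (g : SplitMetric I M t₀ t₁) (p : Slab t₀ t₁ M) {w : ℝ} (hw : w ≠ 0) :
    g.form p w 0 < 0 := by
  have := mul_pos (pow_pos (g.lapse_pos p) 2) (sq_pos_of_ne_zero hw)
  simp only [SplitMetric.form, map_zero]
  linarith

variable [Fact (t₀ < t₁)]

theorem lintegral_deriv_of_causal {g₁ g₂ : SplitMetric I M t₀ t₁} {τ : Slab t₀ t₁ M → ℝ}
    (hτ : MDifferentiable ((𝓡∂ 1).prod I) 𝓘(ℝ, ℝ) τ)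
    (hτ₁ : IsTimeFunction g₁.cone τ) (hτ₂ : IsTimeFunction g₂.cone τ)
    {α : ℝ → Slab t₀ t₁ M} {a b : ℝ} (hab : a < b) (h : IsSmoothOn I α a b)
    (hc : IsFutureOn (fun _ => jointCone g₁ g₂) α a b ∨
      IsPastOn (fun _ => jointCone g₁ g₂) α a b) :
    ∫⁻ u in Icc a b, ENNReal.ofReal |deriv (fun r => τ (α r)) u| =
      ENNReal.ofReal |τ (α b) - τ (α a)| := by
  have hcont : ContinuousOn (fun r => τ (α r)) (Icc a b) := hτ₁.1.comp_continuousOn h.continuousOn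
  rcases hc with hf | hp
  · exact lintegral_deriv_of_nonneg hab.le hcont fun s hs =>
      exists_hasDerivAt_of_cone hτ hτ₁ hτ₂ h hs (hf s (Ioo_subset_Icc_self hs))
  · refine lintegral_deriv_of_nonpos hab.le hcont fun s hs => ?_
    have hs' : -s ∈ Ioo (-b) (-a) := ⟨neg_lt_neg hs.2, neg_lt_neg hs.1⟩
    obtain ⟨d, hd, h'⟩ := exists_hasDerivAt_of_cone hτ hτ₁ hτ₂
      (h.comp contDiff_neg (mapsTo_neg_Icc a b)) hs'
      (hp.reverse h hab (-s) (Ioo_subset_Icc_self hs'))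
    refine ⟨-d, neg_nonpos.2 hd, ?_⟩
    have := h'.comp s (hasDerivAt_neg s)
    simpa [Function.comp_def] using this

/-- The curve is the affine lift of `c`, future or past directed according to the sign of `w`. The
bound on the form is required at all times `r` because the time changes along the lift. -/
theorem nullDist_le_of_form_nonpos {g : SplitMetric I M t₀ t₁} {τ : Slab t₀ t₁ M → ℝ} {t w : ℝ}
    (hw : w ≠ 0) (ht : t ∈ Icc t₀ t₁) (htw : t + w ∈ Icc t₀ t₁) {c : ℝ → M}
    (hc : ContMDiffOn 𝓘(ℝ, ℝ) I ∞ c (Icc 0 1))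
    (hform : ∀ u ∈ Icc (0 : ℝ) 1, ∀ r : Icc t₀ t₁,
      g.form (r, c u) w (mfderivWithin 𝓘(ℝ, ℝ) I c (Icc 0 1) u (1 : ℝ)) ≤ 0) :
    nullDist g.cone τ (⟨t, ht⟩, c 0) (⟨t + w, htw⟩, c 1) ≤
      ENNReal.ofReal |τ (⟨t + w, htw⟩, c 1) - τ (⟨t, ht⟩, c 0)| := by
  have hmem : ∀ u ∈ Icc (0 : ℝ) 1, t + w * (u - 0) ∈ Icc t₀ t₁ := by
    intro u hu
    have := (convex_Icc t₀ t₁).add_smul_mem ht htw hu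
    simpa [mul_comm] using this
  have e₀ : affineLift t₀ t₁ t w 0 c 0 = (⟨t, ht⟩, c 0) := by
    simp [affineLift, projIcc_of_mem _ ht]
  have e₁ : affineLift t₀ t₁ t w 0 c 1 = (⟨t + w, htw⟩, c 1) := by
    simp [affineLift, projIcc_of_mem _ htw]
  have key := nullDist_le_of_causal (τ := τ) (C := g.cone) zero_lt_one
    (isSmoothOn_affineLift hc hmem) ?_
  · rwa [e₀, e₁] at key
  rcases hw.lt_or_gt with hw | hw
  · refine Or.inr fun u hu => ?_
    rw [timeVelocity_affineLift zero_lt_one hmem hu]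
    exact ⟨neg_pos.2 hw, by rw [form_neg]; exact hform u hu _⟩
  · refine Or.inl fun u hu => ?_
    rw [timeVelocity_affineLift zero_lt_one hmem hu]
    exact ⟨hw, hform u hu _⟩

theorem nullDist_vertical_le (g : SplitMetric I M t₀ t₁) (τ : Slab t₀ t₁ M → ℝ)
    (t t' : Icc t₀ t₁) (x : M) :
    nullDist g.cone τ (t, x) (t', x) ≤ ENNReal.ofReal |τ (t', x) - τ (t, x)| := by
  by_cases h : t = t'
  · simp [h, nullDist_self]
  have hw : (t' - t : ℝ) ≠ 0 := sub_ne_zero.2 fun e => h (Subtype.ext e.symm)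
  have ht' : (t + (t' - t) : ℝ) ∈ Icc t₀ t₁ := by simp
  have key := nullDist_le_of_form_nonpos (g := g) (τ := τ) hw t.2 ht' (c := fun _ => x)
    contMDiffOn_const fun u hu r => by
      rw [mfderivWithin_const]; exact (form_zero_neg g _ hw).le
  have e : (⟨t + (t' - t), ht'⟩ : Icc t₀ t₁) = t' := Subtype.ext (by simp)
  simpa only [e, Subtype.coe_eta] using key

/-- Straight segments in a chart, run through fast enough in time, are causal. -/
theorem eventually_nullDist_diagonal_le (g : SplitMetric I M t₀ t₁) (τ : Slab t₀ t₁ M → ℝ)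
    {t w : ℝ} (hw : w ≠ 0) (ht : t ∈ Icc t₀ t₁) (htw : t + w ∈ Icc t₀ t₁) (x : M) :
    ∀ᶠ y in nhds x, nullDist g.cone τ (⟨t, ht⟩, x) (⟨t + w, htw⟩, y) ≤
      ENNReal.ofReal |τ (⟨t + w, htw⟩, y) - τ (⟨t, ht⟩, x)| := by
  have : IsManifold I 1 M := .of_le (n := ∞) (by simp)
  obtain ⟨φ, hφ⟩ : ∃ φ : PartialEquiv M E, φ = extChartAt I x := ⟨_, rfl⟩
  have hx : x ∈ φ.source := hφ ▸ mem_extChartAt_source x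
  have hsymm : ContMDiffOn 𝓘(ℝ, E) I ∞ φ.symm φ.target := hφ ▸ contMDiffOn_extChartAt_symm x
  have huniq : UniqueMDiffOn 𝓘(ℝ, E) φ.target :=
    hφ ▸ (uniqueDiffOn_extChartAt_target x).uniqueMDiffOn
  obtain ⟨A, hA⟩ : ∃ A : E × E → TangentBundle I M, A = fun p =>
    ⟨φ.symm p.1, mfderivWithin 𝓘(ℝ, E) I φ.symm φ.target p.1 p.2⟩ := ⟨_, rfl⟩
  have hAcont : ContinuousOn A (φ.target ×ˢ univ) := by
    have h₁ := hsymm.continuousOn_tangentMapWithin (by simp) huniq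
    have h₂ : Continuous fun p : E × E => (⟨p.1, p.2⟩ : TangentBundle 𝓘(ℝ, E) E) :=
      (tangentBundleModelSpaceHomeomorph 𝓘(ℝ, E)).symm.continuous
    rw [hA]
    exact h₁.comp h₂.continuousOn fun p hp => hp.1
  have hA₀ : A (φ x, 0) = ⟨x, 0⟩ := by
    rw [hA]
    change (⟨φ.symm (φ x), mfderivWithin 𝓘(ℝ, E) I φ.symm φ.target (φ x) 0⟩ :
      TangentBundle I M) = _
    rw [map_zero, φ.left_inv hx]
  -- With zero spatial part, `w ∂_t` is timelike at every time; compactness of `[t₀, t₁]` gives one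
  -- neighbourhood for all `r`.
  have hnear : ∀ᶠ V in nhds (⟨x, 0⟩ : TangentBundle I M), ∀ r : Icc t₀ t₁,
      g.form (r, V.proj) w V.snd < 0 := by
    have h := isCompact_univ.eventually_forall_of_forall_eventually
      (x₀ := (⟨x, 0⟩ : TangentBundle I M)) (K := (univ : Set (Icc t₀ t₁)))
      (P := fun V r => g.form (r, V.proj) w V.snd < 0) fun r _ => by
        have hcont : Continuous fun q : TangentBundle I M × Icc t₀ t₁ =>
            ((q.2, w, q.1) : Icc t₀ t₁ × ℝ × TangentBundle I M) := by fun_prop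
        exact ((continuous_form g).comp hcont).continuousAt.eventually_lt
          (f := fun q : TangentBundle I M × Icc t₀ t₁ => g.form (q.2, q.1.proj) w q.1.snd)
          (x₀ := (⟨x, 0⟩, r)) continuousAt_const (form_zero_neg g (r, x) hw)
    simpa using h
  have hAev : ∀ᶠ p in nhdsWithin (φ x, (0 : E)) (φ.target ×ˢ univ), ∀ r : Icc t₀ t₁,
      g.form (r, (A p).proj) w (A p).snd < 0 := by
    have := hAcont (φ x, 0) ⟨φ.map_source hx, mem_univ _⟩
    rw [ContinuousWithinAt, hA₀] at this
    exact this.eventually hnear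
  obtain ⟨ε, hε, hgood⟩ := Metric.mem_nhdsWithin_iff.1 hAev
  obtain ⟨δ, hδ, htarget⟩ := Metric.mem_nhdsWithin_iff.1
    (hφ ▸ extChartAt_target_mem_nhdsWithin (I := I) x : φ.target ∈ nhdsWithin (φ x) (range I))
  have hclose : ∀ᶠ y in nhds x, φ y ∈ Metric.ball (φ x) (min ε δ) := by
    have hc : ContinuousAt φ x := hφ ▸ continuousAt_extChartAt x
    exact hc.eventually (Metric.ball_mem_nhds _ (lt_min hε hδ))
  have hsource : ∀ᶠ y in nhds x, y ∈ φ.source := hφ ▸ extChartAt_source_mem_nhds x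
  filter_upwards [hclose, hsource] with y hy hys
  have hrange : ∀ z ∈ φ.source, φ z ∈ range I := fun z hz =>
    extChartAt_target_subset_range (I := I) x (hφ ▸ φ.map_source hz)
  obtain ⟨ℓ, hℓ⟩ : ∃ ℓ : ℝ → E, ℓ = fun u => φ x + u • (φ y - φ x) := ⟨_, rfl⟩
  have hball : ∀ u ∈ Icc (0 : ℝ) 1, ℓ u ∈ Metric.ball (φ x) (min ε δ) := fun u hu => hℓ ▸
    (convex_ball _ _).add_smul_sub_mem (Metric.mem_ball_self (lt_min hε hδ)) hy hu
  -- Convexity of `range I` keeps the segment in the chart also at boundary and corner points.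
  have hmem : MapsTo ℓ (Icc 0 1) φ.target := fun u hu =>
    htarget ⟨Metric.ball_subset_ball (min_le_right _ _) (hball u hu), hℓ ▸
      I.convex_range.add_smul_sub_mem (hrange x hx) (hrange y hys) hu⟩
  have hℓs : ContDiff ℝ ∞ ℓ := by rw [hℓ]; fun_prop
  have hℓd : ∀ u, HasDerivAt ℓ (φ y - φ x) u := fun u => by
    rw [hℓ]
    simpa using ((hasDerivAt_id u).smul_const (φ y - φ x)).const_add (φ x)
  have hc : ContMDiffOn 𝓘(ℝ, ℝ) I ∞ (fun u => φ.symm (ℓ u)) (Icc 0 1) :=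
    hsymm.comp (contMDiff_iff_contDiff.2 hℓs).contMDiffOn hmem
  have hc₀ : φ.symm (ℓ 0) = x := by simp [hℓ, φ.left_inv hx]
  have hc₁ : φ.symm (ℓ 1) = y := by simp [hℓ, φ.left_inv hys]
  have key := nullDist_le_of_form_nonpos (g := g) (τ := τ) hw ht htw hc fun u hu r => ?_
  · simpa only [hc₀, hc₁] using key
  have hvel : (mfderivWithin 𝓘(ℝ, ℝ) I (fun u => φ.symm (ℓ u)) (Icc 0 1) u (1 : ℝ) : E) =
      mfderivWithin 𝓘(ℝ, E) I φ.symm φ.target (ℓ u) (φ y - φ x) := by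
    have h₁ := (hsymm.mdifferentiableOn (by simp) (ℓ u) (hmem hu)).hasMFDerivWithinAt
    have h₂ := h₁.comp u (hasMFDerivWithinAt_iff_hasFDerivWithinAt.2
      (hℓd u).hasDerivWithinAt.hasFDerivWithinAt) hmem
    have h₃ := h₂.mfderivWithin (uniqueMDiffWithinAt_Icc zero_lt_one hu)
    refine (congrArg (fun L : ℝ →L[ℝ] E => L 1) h₃).trans ?_
    change mfderivWithin 𝓘(ℝ, E) I φ.symm φ.target (ℓ u) ((1 : ℝ) • (φ y - φ x)) = _
    rw [one_smul]
  rw [hvel]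
  have hp : (ℓ u, φ y - φ x) ∈ Metric.ball (φ x, (0 : E)) ε ∩ φ.target ×ˢ univ := by
    refine ⟨?_, hmem hu, mem_univ _⟩
    have h₁ := hball u hu
    rw [Metric.mem_ball] at h₁ hy ⊢
    rw [Prod.dist_eq, max_lt_iff]
    refine ⟨h₁.trans_le (min_le_left _ _), ?_⟩
    rw [dist_zero_right, ← dist_eq_norm]
    exact hy.trans_le (min_le_left _ _)
  have := hgood hp r
  subst hA
  exact this.le

/-- A nearby point is reached by a steep diagonal over the right spatial point, followed by a
vertical correction in time. -/
theorem eventually_nullDist_le (g : SplitMetric I M t₀ t₁) {τ : Slab t₀ t₁ M → ℝ}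
    (hτ : Continuous τ) (p : Slab t₀ t₁ M) {ε : ℝ≥0∞} (hε : 0 < ε) :
    ∀ᶠ q in nhds p, nullDist g.cone τ p q ≤ ε := by
  obtain ⟨⟨t, ht⟩, x⟩ := p
  -- The diagonal costs at most `η` and the vertical correction at most `2 * η`.
  obtain ⟨η, hη, hηε⟩ : ∃ η : ℝ, 0 < η ∧ ENNReal.ofReal (η + 2 * η) ≤ ε := by
    rcases eq_or_ne ε ⊤ with rfl | h
    · exact ⟨1, one_pos, le_top⟩
    · refine ⟨ε.toReal / 3, div_pos (ENNReal.toReal_pos hε.ne' h) three_pos, ?_⟩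
      rw [show ε.toReal / 3 + 2 * (ε.toReal / 3) = ε.toReal by ring, ENNReal.ofReal_toReal h]
  have hτp : ∀ᶠ q in nhds ((⟨t, ht⟩, x) : Slab t₀ t₁ M), |τ q - τ (⟨t, ht⟩, x)| < η := by
    have := Metric.continuousAt_iff'.1 (hτ.continuousAt (x := ((⟨t, ht⟩, x) : Slab t₀ t₁ M))) η hη
    simpa only [Real.dist_eq] using this
  rw [nhds_prod_eq] at hτp
  obtain ⟨U, hU, V, hV, hUV⟩ := Filter.mem_prod_iff.1 hτp
  obtain ⟨δ, hδ, hball⟩ := Metric.mem_nhds_iff.1 hU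
  -- Forward in the lower half of the slab and backward in the upper half, so that the curve does
  -- not leave it.
  obtain ⟨w, hw, htw, hwδ⟩ : ∃ w : ℝ, w ≠ 0 ∧ t + w ∈ Icc t₀ t₁ ∧ |w| < δ := by
    have hlt := (Fact.out : t₀ < t₁)
    obtain ⟨m, hm, hm₁, hm₂⟩ : ∃ m > 0, m < δ ∧ m ≤ (t₁ - t₀) / 2 :=
      ⟨min (δ / 2) ((t₁ - t₀) / 2), lt_min (by linarith) (by linarith),
        (min_le_left _ _).trans_lt (by linarith), min_le_right _ _⟩
    rcases le_total t ((t₀ + t₁) / 2) with h | h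
    · exact ⟨m, hm.ne', ⟨by linarith [ht.1], by linarith⟩, by rwa [abs_of_pos hm]⟩
    · exact ⟨-m, (neg_neg_of_pos hm).ne, ⟨by linarith, by linarith [ht.2]⟩,
        by rwa [abs_neg, abs_of_pos hm]⟩
  have htU : (⟨t + w, htw⟩ : Icc t₀ t₁) ∈ U := hball (by
    rw [Metric.mem_ball, Subtype.dist_eq, Real.dist_eq]; simpa using hwδ)
  rw [nhds_prod_eq]
  filter_upwards [Filter.prod_mem_prod hU (Filter.inter_mem hV
    (eventually_nullDist_diagonal_le g τ hw ht htw x))] with q hq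
  have h₁ : |τ (⟨t + w, htw⟩, q.2) - τ (⟨t, ht⟩, x)| < η := hUV ⟨htU, hq.2.1⟩
  have h₂ : |τ q - τ (⟨t, ht⟩, x)| < η := hUV ⟨hq.1, hq.2.1⟩
  have h₃ : |τ q - τ (⟨t + w, htw⟩, q.2)| ≤ 2 * η := by
    rw [abs_lt] at h₁ h₂
    exact abs_le.2 ⟨by linarith, by linarith⟩
  refine le_trans ?_ hηε
  rw [ENNReal.ofReal_add hη.le (by linarith)]
  refine (nullDist_triangle _ (⟨t + w, htw⟩, q.2) _).trans (add_le_add ?_ ?_)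
  · exact le_trans hq.2.2 (ENNReal.ofReal_le_ofReal h₁.le)
  · exact (nullDist_vertical_le g τ _ _ _).trans (ENNReal.ofReal_le_ofReal h₃)

/-- The points at finite distance from `p` form an open and closed set in a connected slab. -/
theorem nullDist_lt_top [ConnectedSpace M] (g : SplitMetric I M t₀ t₁) {τ : Slab t₀ t₁ M → ℝ}
    (hτ : Continuous τ) (p q : Slab t₀ t₁ M) : nullDist g.cone τ p q < ⊤ := by
  have : PreconnectedSpace (Icc t₀ t₁) := isPreconnected_iff_preconnectedSpace.1 isPreconnected_Icc
  have hclopen : IsClopen {q | nullDist g.cone τ p q < ⊤} := by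
    have hnear : ∀ q, ∀ᶠ r in nhds q, nullDist g.cone τ q r < ⊤ := fun q =>
      (eventually_nullDist_le g hτ q one_pos).mono fun r hr => hr.trans_lt ENNReal.one_lt_top
    refine ⟨⟨isOpen_iff_mem_nhds.2 fun q hq => ?_⟩, isOpen_iff_mem_nhds.2 fun q hq => ?_⟩
    · filter_upwards [hnear q] with r hr hlt
      refine hq ((nullDist_triangle p r q).trans_lt (ENNReal.add_lt_top.2 ⟨hlt, ?_⟩))
      rwa [nullDist_comm]
    · filter_upwards [hnear q] with r hr
      exact (nullDist_triangle p q r).trans_lt (ENNReal.add_lt_top.2 ⟨hq, hr⟩)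
  have huniv := hclopen.eq_univ ⟨p, by simp [nullDist_self]⟩
  exact (huniv.symm ▸ mem_univ q : q ∈ {q | nullDist g.cone τ p q < ⊤})

end Causal

/-- The intermediate parameter `s` serves to charge a curve for a visit to the bottom. -/
theorem ofReal_add_abs_sub_le_lintegral {f : ℝ → ℝ} {a b s : ℝ} (hf : ContDiffOn ℝ ∞ f (Icc a b))
    (hs : s ∈ Icc a b) :
    ENNReal.ofReal (|f s - f a| + |f b - f s|) ≤ ∫⁻ u in Icc a b, ENNReal.ofReal |deriv f u| := by
  have hd : ∀ u ∈ Ioo a b, DifferentiableAt ℝ f u := fun u hu =>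
    (hf.contDiffAt (Icc_mem_nhds hu.1 hu.2)).differentiableAt (by simp)
  have h₁ := ofReal_abs_sub_le_lintegral (hf.continuousOn.mono (Icc_subset_Icc_right hs.2))
    (fun u hu => hd u ⟨hu.1, hu.2.trans_le hs.2⟩) le_rfl hs.1 le_rfl
  have h₂ := ofReal_abs_sub_le_lintegral (hf.continuousOn.mono (Icc_subset_Icc_left hs.1))
    (fun u hu => hd u ⟨hs.1.trans_lt hu.1, hu.2⟩) le_rfl hs.2 le_rfl
  have h₃ := variationIntegral_add f (fun _ => 0) hs.1 hs.2
  simp only [variationIntegral, deriv_const, abs_zero, add_zero] at h₃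
  rw [ENNReal.ofReal_add (abs_nonneg _) (abs_nonneg _), h₃]
  exact add_le_add h₁ h₂

theorem ofReal_abs_sub_triangle (a b c : ℝ) :
    ENNReal.ofReal |c - a| ≤ ENNReal.ofReal |b - a| + ENNReal.ofReal |c - b| := by
  rw [← ENNReal.ofReal_add (abs_nonneg _) (abs_nonneg _), add_comm]
  exact ENNReal.ofReal_le_ofReal (abs_sub_le c b a)

/-! ### The sheets of the glued space. -/

namespace Glued

variable {M : Type*} {t₀ t₁ H : ℝ} {W : Set (Slab t₀ t₁ M)}

@[simp] theorem base_lower (x : Slab t₀ t₁ M) (h : Icc 0 H) : (lower W x h).base = x := rfl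

@[simp] theorem base_upper (x : Slab t₀ t₁ M) : (upper H W x).base = x := rfl

@[simp] theorem height_lower (x : Slab t₀ t₁ M) (h : Icc 0 H) : (lower W x h).height = h := rfl

@[simp] theorem height_upper (x : Slab t₀ t₁ M) : (upper H W x).height = H := rfl

theorem exists_rep (z : Glued H W) : (∃ x h, z = lower W x h) ∨ ∃ x, z = upper H W x := by
  induction z using Quot.ind with
  | mk a => rcases a with ⟨x, h⟩ | x
            · exact Or.inl ⟨x, h, rfl⟩
            · exact Or.inr ⟨x, rfl⟩

theorem lower_eq_upper {x : Slab t₀ t₁ M} (hx : x ∈ W) {h : Icc 0 H} (hh : (h : ℝ) = H) :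
    lower W x h = upper H W x :=
  Quot.sound ⟨x, hx, h, hh, rfl, rfl⟩

/-- The points of the sheet `L × {H + 1}`. -/
def IsUpper : Glued H W → Prop :=
  Quot.lift (Sum.elim (fun y => y.1 ∈ W ∧ (y.2 : ℝ) = H) fun _ => True) (by
    rintro _ _ ⟨x, hx, y, hy, rfl, rfl⟩
    exact eq_true ⟨hx, hy⟩)

theorem isUpper_upper (x : Slab t₀ t₁ M) : (upper H W x).IsUpper := trivial

theorem isUpper_lower_iff {x : Slab t₀ t₁ M} {h : Icc 0 H} :
    (lower W x h).IsUpper ↔ x ∈ W ∧ (h : ℝ) = H := Iff.rfl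

theorem phi₂_eq_upper (hH : 0 ≤ H) (x : Slab t₀ t₁ M) : phi₂ hH W x = upper H W x := by
  unfold phi₂
  split_ifs with hx
  · exact lower_eq_upper hx rfl
  · rfl

end Glued

/-! ### The glued distance and its upper bounds. -/

section GluedDist

variable {E : Type*} [NormedAddCommGroup E] [NormedSpace ℝ E]
  {HM : Type*} [TopologicalSpace HM] {I : ModelWithCorners ℝ E HM}
  {M : Type*} [TopologicalSpace M] [ChartedSpace HM M] [IsManifold I ∞ M]
  {t₀ t₁ : ℝ} {H : ℝ} {W : Set (Slab t₀ t₁ M)}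
  {g₁ g₂ : SplitMetric I M t₀ t₁} {τ : Slab t₀ t₁ M → ℝ}

theorem coneAt_le_jointCone (z : Glued H W) (p : Slab t₀ t₁ M) (r : ℝ) (v : TangentSpace I p.2)
    (h : coneAt g₁ g₂ z p r v) : jointCone g₁ g₂ p r v := by
  unfold coneAt at h
  split_ifs at h
  · exact Or.inl h
  · exact Or.inr h

variable [Fact (t₀ < t₁)]

theorem gluedDist_self (z : Glued H W) : gluedDist g₁ g₂ τ z z = 0 := by
  rw [gluedDist_eq_chainDist, PieceClass.chainDist_self]

theorem gluedDist_comm (z z' : Glued H W) :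
    gluedDist g₁ g₂ τ z z' = gluedDist g₁ g₂ τ z' z := by
  simp only [gluedDist_eq_chainDist, PieceClass.chainDist_comm z z']

theorem gluedDist_triangle (z₁ z₂ z₃ : Glued H W) :
    gluedDist g₁ g₂ τ z₁ z₃ ≤ gluedDist g₁ g₂ τ z₁ z₂ + gluedDist g₁ g₂ τ z₂ z₃ := by
  simp only [gluedDist_eq_chainDist]
  exact PieceClass.chainDist_triangle z₁ z₂ z₃

theorem gluedDist_le_mixedLength {γ : ℝ → Glued H W} {a b : ℝ} (hab : a < b)
    (h : IsMixedPiece g₁ g₂ γ a b) :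
    gluedDist g₁ g₂ τ (γ a) (γ b) ≤ mixedLength τ γ a b := by
  rw [gluedDist_eq_chainDist]
  exact PieceClass.chainDist_le_len (P := mixedPieces g₁ g₂ τ) hab h

theorem le_add_gluedDist {F : Glued H W → ℝ≥0∞}
    (hF : ∀ (γ : ℝ → Glued H W) (a b : ℝ), a < b → IsMixedPiece g₁ g₂ γ a b →
      F (γ b) ≤ F (γ a) + mixedLength τ γ a b)
    (z z' : Glued H W) : F z' ≤ F z + gluedDist g₁ g₂ τ z z' := by
  rw [gluedDist_eq_chainDist]
  exact PieceClass.le_add_chainDist (P := mixedPieces g₁ g₂ τ) hF z z'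

/-- The part `∫ |h'|` of the length of a curve in the glued space. -/
def heightVariation (γ : ℝ → Glued H W) (a b : ℝ) : ℝ≥0∞ :=
  ∫⁻ u in Icc a b, ENNReal.ofReal |deriv (fun r => (γ r).height) u|

namespace IsMixedPiece

variable {γ : ℝ → Glued H W} {a b : ℝ}

theorem jointCausal (h : IsMixedPiece g₁ g₂ γ a b) :
    (IsFutureOn (fun _ => jointCone g₁ g₂) (fun s => (γ s).base) a b ∨
      IsPastOn (fun _ => jointCone g₁ g₂) (fun s => (γ s).base) a b) ∨
      ∀ s ∈ Icc a b, (γ s).base = (γ a).base := by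
  rcases h.2.2.2 with hf | hp | hc
  · exact Or.inl (Or.inl (hf.mono fun _ _ => coneAt_le_jointCone _))
  · exact Or.inl (Or.inr (hp.mono fun _ _ => coneAt_le_jointCone _))
  · exact Or.inr hc

theorem nullDist_joint_le (h : IsMixedPiece g₁ g₂ γ a b) (hab : a < b) :
    nullDist (jointCone g₁ g₂) τ (γ a).base (γ b).base ≤
      ENNReal.ofReal |τ (γ b).base - τ (γ a).base| := by
  rcases h.jointCausal with hc | hc
  · exact nullDist_le_of_causal (β := fun s => (γ s).base) hab h.2.1 hc
  · rw [hc b (right_mem_Icc.2 hab.le), nullDist_self]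
    exact zero_le

/-- Away from height 0 only the cones of `g₂` are in force. -/
theorem nullDist_snd_le_or (h : IsMixedPiece g₁ g₂ γ a b) (hab : a < b) :
    nullDist g₂.cone τ (γ a).base (γ b).base ≤ ENNReal.ofReal |τ (γ b).base - τ (γ a).base| ∨
      ∃ s ∈ Icc a b, (γ s).height = 0 := by
  by_cases h₀ : ∃ s ∈ Icc a b, (γ s).height = 0
  · exact Or.inr h₀
  · have hcone : ∀ s ∈ Icc a b, ∀ p r v, coneAt g₁ g₂ (γ s) p r v → g₂.cone p r v := by
      intro s hs p r v hv
      rwa [coneAt, if_neg fun e => h₀ ⟨s, hs, e⟩] at hv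
    refine Or.inl ?_
    rcases h.2.2.2 with hf | hp | hc
    · exact nullDist_le_of_causal (β := fun s => (γ s).base) hab h.2.1 (Or.inl (hf.mono hcone))
    · exact nullDist_le_of_causal (β := fun s => (γ s).base) hab h.2.1 (Or.inr (hp.mono hcone))
    · rw [hc b (right_mem_Icc.2 hab.le), nullDist_self]
      exact zero_le

theorem mixedLength_eq (h : IsMixedPiece g₁ g₂ γ a b) (hab : a < b)
    (hτ : MDifferentiable ((𝓡∂ 1).prod I) 𝓘(ℝ, ℝ) τ)
    (hτ₁ : IsTimeFunction g₁.cone τ) (hτ₂ : IsTimeFunction g₂.cone τ) :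
    mixedLength τ γ a b =
      ENNReal.ofReal |τ (γ b).base - τ (γ a).base| + heightVariation γ a b := by
  refine (variationIntegral_eq_add _ _ a b).trans (congrArg (· + heightVariation γ a b) ?_)
  rcases h.jointCausal with hc | hc
  · exact lintegral_deriv_of_causal hτ hτ₁ hτ₂ hab h.2.1 hc
  · refine lintegral_deriv_of_nonneg hab.le (hτ₁.1.comp_continuousOn h.2.1.continuousOn)
      fun s hs => ⟨0, le_rfl, (hasDerivAt_const s (τ (γ a).base)).congr_of_eventuallyEq ?_⟩
    filter_upwards [Icc_mem_nhds hs.1 hs.2] with u hu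
    rw [hc u hu]

theorem ofReal_le_heightVariation (h : IsMixedPiece g₁ g₂ γ a b) {s : ℝ} (hs : s ∈ Icc a b) :
    ENNReal.ofReal (|(γ s).height - (γ a).height| + |(γ b).height - (γ s).height|) ≤
      heightVariation γ a b :=
  ofReal_add_abs_sub_le_lintegral h.2.2.1 hs

theorem ofReal_abs_sub_le_heightVariation (h : IsMixedPiece g₁ g₂ γ a b) (hab : a < b) :
    ENNReal.ofReal |(γ b).height - (γ a).height| ≤ heightVariation γ a b := by
  simpa using h.ofReal_le_heightVariation (left_mem_Icc.2 hab.le)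

end IsMixedPiece

section Upper

/-- A copy `j` of the slab at constant height, inside one sheet and with cones `C`, turns causal
curves into curves of the class `𝒞` of the same length. -/
theorem gluedDist_le_nullDist (hτ : MDifferentiable ((𝓡∂ 1).prod I) 𝓘(ℝ, ℝ) τ)
    (hτ₁ : IsTimeFunction g₁.cone τ) (hτ₂ : IsTimeFunction g₂.cone τ)
    {C : ConeField I M t₀ t₁} {j : Slab t₀ t₁ M → Glued H W} {η : ℝ}
    (hb : ∀ x, (j x).base = x) (hη : ∀ x, (j x).height = η)
    (hj : (∀ x, ∃ y h, j x = Glued.lower W y h) ∨ ∀ x, ∃ y, j x = Glued.upper H W y)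
    (hC : ∀ x, coneAt g₁ g₂ (j x) = C) (x y : Slab t₀ t₁ M) :
    gluedDist g₁ g₂ τ (j x) (j y) ≤ nullDist C τ x y := by
  have key := le_add_nullDist (C := C) (τ := τ) (F := fun y => gluedDist g₁ g₂ τ (j x) (j y))
    (fun β a b hab hs hc => (gluedDist_triangle _ (j (β a)) _).trans
      (add_le_add_right ?_ _)) x y
  · simpa only [gluedDist_self, zero_add] using key
  have hpiece : IsMixedPiece g₁ g₂ (fun s => j (β s)) a b := by
    refine ⟨hj.imp (fun h s _ => h _) (fun h s _ => h _), ?_, ?_, ?_⟩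
    · simpa only [hb] using hs
    · simpa only [hη] using contDiffOn_const
    · simp only [hb, hC]
      exact hc.imp id Or.inl
  refine (gluedDist_le_mixedLength hab hpiece).trans (le_of_eq ?_)
  rw [hpiece.mixedLength_eq hab hτ hτ₁ hτ₂]
  simp [heightVariation, hb, hη]

theorem gluedDist_lower_vertical_le (x : Slab t₀ t₁ M) (h h' : Icc 0 H) :
    gluedDist g₁ g₂ τ (Glued.lower W x h) (Glued.lower W x h') ≤
      ENNReal.ofReal |(h : ℝ) - h'| := by
  wlog hlt : h < h' generalizing h h'
  · rcases (not_lt.1 hlt).eq_or_lt with rfl | h₁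
    · simp [gluedDist_self]
    · rw [gluedDist_comm, abs_sub_comm]
      exact this h' h h₁
  have hH : 0 ≤ H := h.2.1.trans h.2.2
  have hproj : EqOn id (fun u : ℝ => ((projIcc 0 H hH u : Icc 0 H) : ℝ)) (Icc (h : ℝ) h') :=
    fun u hu => by simp [projIcc_of_mem hH ⟨h.2.1.trans hu.1, hu.2.trans h'.2.2⟩]
  have hpiece : IsMixedPiece g₁ g₂ (fun u => Glued.lower W x (projIcc 0 H hH u)) h h' :=
    ⟨Or.inl fun s _ => ⟨_, _, rfl⟩, contMDiffOn_const,
      contDiffOn_id.congr fun u hu => (hproj hu).symm, Or.inr (Or.inr fun _ _ => rfl)⟩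
  have key := gluedDist_le_mixedLength (τ := τ) (Subtype.coe_lt_coe.2 hlt) hpiece
  simp only [projIcc_val] at key
  refine key.trans (le_of_eq ?_)
  refine (variationIntegral_congr (f := fun _ => τ x) (fun _ _ => rfl) hproj).trans ?_
  rw [abs_sub_comm, abs_of_pos (sub_pos.2 (Subtype.coe_lt_coe.2 hlt))]
  simp [variationIntegral]

variable (hτ : MDifferentiable ((𝓡∂ 1).prod I) 𝓘(ℝ, ℝ) τ)
  (hτ₁ : IsTimeFunction g₁.cone τ) (hτ₂ : IsTimeFunction g₂.cone τ)
include hτ hτ₁ hτ₂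

theorem gluedDist_bottom_le (x y : Slab t₀ t₁ M) {h : Icc 0 H} (hh : (h : ℝ) = 0) :
    gluedDist g₁ g₂ τ (Glued.lower W x h) (Glued.lower W y h) ≤ nullDist g₁.cone τ x y :=
  gluedDist_le_nullDist hτ hτ₁ hτ₂ (j := fun x => Glued.lower W x h) (η := h) (fun _ => rfl)
    (fun _ => rfl) (Or.inl fun x => ⟨x, h, rfl⟩)
    (fun _ => by rw [coneAt, Glued.height_lower, if_pos hh]) x y

theorem gluedDist_level_le (x y : Slab t₀ t₁ M) {h : Icc 0 H} (hh : (h : ℝ) ≠ 0) :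
    gluedDist g₁ g₂ τ (Glued.lower W x h) (Glued.lower W y h) ≤ nullDist g₂.cone τ x y :=
  gluedDist_le_nullDist hτ hτ₁ hτ₂ (j := fun x => Glued.lower W x h) (η := h) (fun _ => rfl)
    (fun _ => rfl) (Or.inl fun x => ⟨x, h, rfl⟩)
    (fun _ => by rw [coneAt, Glued.height_lower, if_neg hh]) x y

theorem gluedDist_upper_le (hH : 0 < H) (x y : Slab t₀ t₁ M) :
    gluedDist g₁ g₂ τ (Glued.upper H W x) (Glued.upper H W y) ≤ nullDist g₂.cone τ x y :=
  gluedDist_le_nullDist hτ hτ₁ hτ₂ (j := fun x => Glued.upper H W x) (fun _ => rfl)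
    (fun _ => rfl) (Or.inr fun x => ⟨x, rfl⟩)
    (fun _ => by rw [coneAt, Glued.height_upper, if_neg hH.ne']) x y

theorem gluedDist_lower_le (hH : 0 < H) (x y : Slab t₀ t₁ M) (h h' : Icc 0 H) :
    gluedDist g₁ g₂ τ (Glued.lower W x h) (Glued.lower W y h') ≤
      nullDist g₂.cone τ x y + ENNReal.ofReal |(h : ℝ) - h'| := by
  refine ENNReal.le_of_forall_pos_le_add fun ε hε _ => ?_
  have hε' : (0 : ℝ) < ε := hε
  -- The horizontal motion needs a positive height, where `g₂` is in force. If both heights are 0,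
  -- rising to `e ≤ ε / 2` and coming back costs at most `ε`.
  obtain ⟨k, hk₀, hk⟩ : ∃ k : Icc 0 H, (k : ℝ) ≠ 0 ∧
      |(h : ℝ) - k| + |(k : ℝ) - h'| ≤ |(h : ℝ) - h'| + ε := by
    obtain ⟨e, he, he₁, he₂⟩ : ∃ e : ℝ, 0 < e ∧ e ≤ ε / 2 ∧ e ≤ H :=
      ⟨min (ε / 2) H, lt_min (by linarith) hH, min_le_left _ _, min_le_right _ _⟩
    by_cases hh : (h : ℝ) = 0
    · by_cases hh' : (h' : ℝ) = 0
      · refine ⟨⟨e, he.le, he₂⟩, he.ne', ?_⟩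
        rw [hh, hh']
        simp only [zero_sub, sub_zero, abs_neg, abs_zero, abs_of_pos he]
        linarith
      · exact ⟨h', hh', by simp⟩
    · exact ⟨h, hh, by simp⟩
  calc gluedDist g₁ g₂ τ (Glued.lower W x h) (Glued.lower W y h')
      ≤ gluedDist g₁ g₂ τ (Glued.lower W x h) (Glued.lower W x k) +
        (gluedDist g₁ g₂ τ (Glued.lower W x k) (Glued.lower W y k) +
          gluedDist g₁ g₂ τ (Glued.lower W y k) (Glued.lower W y h')) :=
        (gluedDist_triangle _ _ _).trans (add_le_add_right (gluedDist_triangle _ _ _) _)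
    _ ≤ ENNReal.ofReal |(h : ℝ) - k| + (nullDist g₂.cone τ x y + ENNReal.ofReal |(k : ℝ) - h'|) :=
        add_le_add (gluedDist_lower_vertical_le _ _ _)
          (add_le_add (gluedDist_level_le hτ hτ₁ hτ₂ x y hk₀) (gluedDist_lower_vertical_le _ _ _))
    _ = nullDist g₂.cone τ x y + ENNReal.ofReal (|(h : ℝ) - k| + |(k : ℝ) - h'|) := by
        rw [ENNReal.ofReal_add (abs_nonneg _) (abs_nonneg _)]; ring
    _ ≤ nullDist g₂.cone τ x y + ENNReal.ofReal (|(h : ℝ) - h'| + ε) := by gcongr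
    _ = nullDist g₂.cone τ x y + ENNReal.ofReal |(h : ℝ) - h'| + ε := by
        rw [ENNReal.ofReal_add (abs_nonneg _) hε'.le, ENNReal.ofReal_coe_nnreal, add_assoc]

theorem gluedDist_lt_top [ConnectedSpace M] (hH : 0 < H) (hW : W.Nonempty) (z z' : Glued H W) :
    gluedDist g₁ g₂ τ z z' < ⊤ := by
  obtain ⟨w, hw⟩ := hW
  suffices h : ∀ z : Glued H W, gluedDist g₁ g₂ τ z (Glued.upper H W w) < ⊤ from
    (gluedDist_triangle z _ z').trans_lt
      (ENNReal.add_lt_top.2 ⟨h z, by rw [gluedDist_comm]; exact h z'⟩)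
  intro z
  rcases z.exists_rep with ⟨x, h, rfl⟩ | ⟨x, rfl⟩
  · rw [← Glued.lower_eq_upper hw (h := ⟨H, hH.le, le_rfl⟩) rfl]
    exact (gluedDist_lower_le hτ hτ₁ hτ₂ hH x w h _).trans_lt
      (ENNReal.add_lt_top.2 ⟨nullDist_lt_top g₂ hτ₁.1 x w, ENNReal.ofReal_lt_top⟩)
  · exact (gluedDist_upper_le hτ hτ₁ hτ₂ hH x w).trans_lt (nullDist_lt_top g₂ hτ₁.1 x w)

end Upper

end GluedDist

/-- Smallness of the distance near the diagonal makes it lower semicontinuous, so its minimum over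
the compact `W` is attained. -/
theorem iInf_nullDist_pos {E : Type*} [NormedAddCommGroup E] [NormedSpace ℝ E]
    {HM : Type*} [TopologicalSpace HM] {I : ModelWithCorners ℝ E HM}
    {M : Type*} [TopologicalSpace M] [ChartedSpace HM M] {t₀ t₁ : ℝ} [Fact (t₀ < t₁)]
    {W : Set (Slab t₀ t₁ M)} {C : ConeField I M t₀ t₁} {τ : Slab t₀ t₁ M → ℝ}
    (hnear : ∀ (p : Slab t₀ t₁ M) (ε : ℝ≥0∞), 0 < ε → ∀ᶠ q in nhds p, nullDist C τ p q ≤ ε)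
    (hW : IsCompact W) (hWn : W.Nonempty) {y : Slab t₀ t₁ M}
    (hpos : ∀ w ∈ W, 0 < nullDist C τ w y) : 0 < ⨅ w ∈ W, nullDist C τ w y := by
  have hlsc : LowerSemicontinuousOn (fun w => nullDist C τ w y) W := by
    intro w _ c hc
    obtain ⟨ε, hε, hlt⟩ := ENNReal.lt_iff_exists_add_pos_lt.1 hc
    refine Filter.Eventually.filter_mono nhdsWithin_le_nhds ?_
    filter_upwards [hnear w ε (by exact_mod_cast hε)] with r hr
    by_contra! hle
    refine absurd hlt (not_lt.2 ?_)
    rw [add_comm]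
    exact (nullDist_triangle w r y).trans (add_le_add hr hle)
  obtain ⟨w, hw, hmin⟩ := hlsc.exists_isMinOn hWn hW
  exact (hpos w hw).trans_le (le_iInf₂ fun r hr => hmin hr)

/-! ### Lower bounds for the glued distance. -/

section LowerBounds

variable {E : Type*} [NormedAddCommGroup E] [NormedSpace ℝ E]
  {HM : Type*} [TopologicalSpace HM] {I : ModelWithCorners ℝ E HM}
  {M : Type*} [TopologicalSpace M] [ChartedSpace HM M] [IsManifold I ∞ M]
  {t₀ t₁ : ℝ} [Fact (t₀ < t₁)] {H : ℝ} {W : Set (Slab t₀ t₁ M)}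
  {g₁ g₂ : SplitMetric I M t₀ t₁} {τ : Slab t₀ t₁ M → ℝ}

/-- The comparison of `σ / h²` says that the cones of `g₂` are contained in those of `g₁`. -/
theorem cone_le_of_comparison {M : Type*} [TopologicalSpace M] [ChartedSpace HM M]
    [IsManifold I ∞ M] {t₀ t₁ : ℝ} {g₁ g₂ : SplitMetric I M t₀ t₁}
    (h : ∀ (p : Slab t₀ t₁ M) (v : TangentSpace I p.2),
      g₁.spatial p v v / (g₁.lapse p) ^ 2 ≤ g₂.spatial p v v / (g₂.lapse p) ^ 2)
    (p : Slab t₀ t₁ M) (r : ℝ) (v : TangentSpace I p.2) (hv : g₂.cone p r v) :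
    g₁.cone p r v := by
  refine ⟨hv.1, ?_⟩
  have h₂ := hv.2
  have hp := h p v
  have hl₁ := pow_pos (g₁.lapse_pos p) 2
  have hl₂ := pow_pos (g₂.lapse_pos p) 2
  simp only [SplitMetric.form] at h₂ ⊢
  have h₃ : g₂.spatial p v v / (g₂.lapse p) ^ 2 ≤ r ^ 2 := by
    rw [div_le_iff₀ hl₂]; linarith
  have h₄ := (div_le_iff₀ hl₁).1 (hp.trans h₃)
  linarith

section

variable (hτ : MDifferentiable ((𝓡∂ 1).prod I) 𝓘(ℝ, ℝ) τ)
  (hτ₁ : IsTimeFunction g₁.cone τ) (hτ₂ : IsTimeFunction g₂.cone τ)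
include hτ hτ₁ hτ₂

theorem nullDist_joint_add_le_gluedDist (z z' : Glued H W) :
    nullDist (jointCone g₁ g₂) τ z.base z'.base + ENNReal.ofReal |z.height - z'.height| ≤
      gluedDist g₁ g₂ τ z z' := by
  have key := le_add_gluedDist (g₁ := g₁) (g₂ := g₂) (τ := τ)
    (F := fun z' : Glued H W => nullDist (jointCone g₁ g₂) τ z.base z'.base +
      ENNReal.ofReal |z'.height - z.height|) (fun γ a b hab h => ?_) z z'
  · rw [abs_sub_comm]
    simpa [nullDist_self] using key
  rw [h.mixedLength_eq hab hτ hτ₁ hτ₂, add_add_add_comm]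
  refine add_le_add ?_ ?_
  · exact (nullDist_triangle _ _ _).trans (add_le_add_right (h.nullDist_joint_le hab) _)
  · exact (ofReal_abs_sub_triangle _ _ _).trans
      (add_le_add_right (h.ofReal_abs_sub_le_heightVariation hab) _)

/-- A curve between the two sheets passes through `W`. -/
theorem iInf_nullDist_joint_le_gluedDist (x y : Slab t₀ t₁ M) (h : Icc 0 H) :
    ⨅ w ∈ W, nullDist (jointCone g₁ g₂) τ w y ≤
      gluedDist g₁ g₂ τ (Glued.lower W x h) (Glued.upper H W y) := by
  classical
  -- Zero on the lower sheet, distance from `W` on the upper one. The two prescriptions agree on the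
  -- common points, which lie over `W`.
  obtain ⟨F, hF⟩ : ∃ F : Glued H W → ℝ≥0∞, F = fun z =>
    if ∃ x h, z = Glued.lower W x h then 0
    else ⨅ w ∈ W, nullDist (jointCone g₁ g₂) τ w z.base := ⟨_, rfl⟩
  have hlower : ∀ x h, F (Glued.lower W x h) = 0 := fun x h => by
    rw [hF]; exact if_pos ⟨x, h, rfl⟩
  have hupper : ∀ x, F (Glued.upper H W x) = ⨅ w ∈ W, nullDist (jointCone g₁ g₂) τ w x := by
    intro x
    rw [hF]
    by_cases hx : ∃ x' h, Glued.upper H W x = Glued.lower W x' h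
    · obtain ⟨x', h, hx'⟩ := hx
      obtain rfl : x = x' := congrArg Glued.base hx'
      have hW : x ∈ W :=
        (Glued.isUpper_lower_iff.1 (hx' ▸ Glued.isUpper_upper x)).1
      simp only
      rw [if_pos ⟨x, h, hx'⟩]
      exact (le_antisymm ((iInf₂_le x hW).trans (nullDist_self x).le) zero_le).symm
    · simp only
      rw [if_neg hx, Glued.base_upper]
  have key := le_add_gluedDist (g₁ := g₁) (g₂ := g₂) (τ := τ) (F := F)
    (fun γ a b hab hp => ?_) (Glued.lower W x h) (Glued.upper H W y)
  · rwa [hupper, hlower, zero_add] at key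
  rcases hp.1 with hl | hu
  · obtain ⟨x', h', e⟩ := hl b (right_mem_Icc.2 hab.le)
    rw [e, hlower]
    exact zero_le
  · obtain ⟨xa, ea⟩ := hu a (left_mem_Icc.2 hab.le)
    obtain ⟨xb, eb⟩ := hu b (right_mem_Icc.2 hab.le)
    have hd := hp.nullDist_joint_le (τ := τ) hab
    rw [hp.mixedLength_eq hab hτ hτ₁ hτ₂, ea, eb, hupper, hupper]
    rw [ea, eb, Glued.base_upper, Glued.base_upper] at hd
    rw [ENNReal.iInf₂_add]
    refine le_iInf₂ fun w hw => (iInf₂_le w hw).trans ((nullDist_triangle _ xa _).trans ?_)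
    exact add_le_add_right (hd.trans le_self_add) _

/-- Leaving `L × {H + 1}` through `W`, touching the bottom and coming back costs at least `2 H` in
height, which pays for a shortcut along the bottom. -/
theorem nullDist_snd_le_gluedDist_upper (hH : 0 < H)
    (hle : ∀ p q, nullDist g₁.cone τ p q ≤ nullDist (jointCone g₁ g₂) τ p q)
    (hle' : ∀ p q, nullDist g₁.cone τ p q ≤ nullDist g₂.cone τ p q)
    (hW : ∀ x ∈ W, ∀ y ∈ W, nullDist g₂.cone τ x y ≤
      nullDist g₁.cone τ x y + ENNReal.ofReal (2 * H)) (x y : Slab t₀ t₁ M) :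
    nullDist g₂.cone τ x y ≤ gluedDist g₁ g₂ τ (Glued.upper H W x) (Glued.upper H W y) := by
  classical
  obtain ⟨d₁, hd₁⟩ : ∃ d₁, d₁ = nullDist g₁.cone τ := ⟨_, rfl⟩
  obtain ⟨d₂, hd₂⟩ : ∃ d₂, d₂ = nullDist g₂.cone τ := ⟨_, rfl⟩
  rw [← hd₁] at hle hle' hW
  rw [← hd₂] at hle' hW ⊢
  have htri₁ : ∀ p q r, d₁ p r ≤ d₁ p q + d₁ q r := fun p q r => hd₁ ▸ nullDist_triangle p q r
  have htri₂ : ∀ p q r, d₂ p r ≤ d₂ p q + d₂ q r := fun p q r => hd₂ ▸ nullDist_triangle p q r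
  have hself : ∀ p, d₂ p p = 0 := fun p => hd₂ ▸ nullDist_self p
  -- Model cost of reaching `(y, h)` in the lower sheet: enter through `w`, then either avoid the
  -- bottom or descend to it, travel with `d₁` and climb to `h`.
  obtain ⟨B, hB⟩ : ∃ B : Slab t₀ t₁ M → ℝ → ℝ≥0∞, B = fun y h => ⨅ w ∈ W, (d₂ x w +
    min (d₂ w y + ENNReal.ofReal (H - h)) (d₁ w y + ENNReal.ofReal (H + h))) := ⟨_, rfl⟩
  -- The gluing condition for `F`. At height `H` the route along the bottom carries the surcharge `2
  -- * H`, which by `hW` makes it no cheaper than `d₂`.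
  have hBtop : ∀ y ∈ W, B y H = d₂ x y := by
    intro y hy
    rw [hB]
    refine le_antisymm ((iInf₂_le y hy).trans ?_) (le_iInf₂ fun w hw => ?_)
    · refine (add_le_add_right (min_le_left _ _) _).trans ?_
      simp [hself]
    · refine (htri₂ x w y).trans (add_le_add_right (le_min le_self_add ?_) _)
      rw [← two_mul]
      exact hW w hw y hy
  obtain ⟨F, hF⟩ : ∃ F : Glued H W → ℝ≥0∞, F = fun z =>
    if z.IsUpper then d₂ x z.base else B z.base z.height := ⟨_, rfl⟩
  have hupper : ∀ y, F (Glued.upper H W y) = d₂ x y := fun y => by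
    rw [hF]; exact if_pos (Glued.isUpper_upper y)
  have hlower : ∀ y h, F (Glued.lower W y h) = B y h := by
    intro y h
    rw [hF]
    by_cases hu : (Glued.lower W y h).IsUpper
    · simp only
      rw [if_pos hu]
      rw [Glued.isUpper_lower_iff] at hu
      rw [hu.2, hBtop y hu.1, Glued.base_lower]
    · exact if_neg hu
  have key := le_add_gluedDist (g₁ := g₁) (g₂ := g₂) (τ := τ) (F := F)
    (fun γ a b hab hp => ?_) (Glued.upper H W x) (Glued.upper H W y)
  · rwa [hupper, hupper, hself, zero_add] at key
  have hjoint := (hle _ _).trans (hp.nullDist_joint_le (τ := τ) hab)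
  have hsnd := hp.nullDist_snd_le_or (τ := τ) hab
  rw [← hd₂] at hsnd
  rw [hp.mixedLength_eq hab hτ hτ₁ hτ₂]
  obtain ⟨T, hT⟩ : ∃ T, T = ENNReal.ofReal |τ (γ b).base - τ (γ a).base| := ⟨_, rfl⟩
  rw [← hT] at hjoint hsnd ⊢
  rcases hp.1 with hl | hu
  · obtain ⟨xa, ha, ea⟩ := hl a (left_mem_Icc.2 hab.le)
    obtain ⟨xb, hb, eb⟩ := hl b (right_mem_Icc.2 hab.le)
    have hV := hp.ofReal_abs_sub_le_heightVariation hab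
    have hV' := fun s hs => hp.ofReal_le_heightVariation (s := s) hs
    simp only [ea, eb, Glued.base_lower, Glued.height_lower] at hjoint hsnd hV hV'
    rw [ea, eb, hlower, hlower, hB]
    simp only
    rw [ENNReal.iInf₂_add]
    refine le_iInf₂ fun w hw => (iInf₂_le w hw).trans ?_
    rw [add_assoc]
    refine add_le_add_right ?_ _
    have hreal : ∀ {p q r : ℝ}, p ≤ q + r → ENNReal.ofReal r ≤ heightVariation γ a b →
        ENNReal.ofReal p ≤ ENNReal.ofReal q + heightVariation γ a b := fun h₁ h₂ =>
      (ENNReal.ofReal_le_ofReal h₁).trans (ENNReal.ofReal_add_le.trans (add_le_add_right h₂ _))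
    have hd₁' : d₁ w xb ≤ d₁ w xa + T := (htri₁ w xa xb).trans (add_le_add_right hjoint _)
    rw [min_add]
    refine le_min ?_ ?_
    · rw [add_add_add_comm]
      rcases hsnd with hsnd | ⟨s, hs, h₀⟩
      · refine (min_le_left _ _).trans (add_le_add ?_ (hreal ?_ hV))
        · exact (htri₂ w xa xb).trans (add_le_add_right hsnd _)
        · linarith [neg_abs_le ((hb : ℝ) - ha)]
      -- A piece touching the bottom has height variation at least `ha + hb`, exactly what turns `H
      -- - ha` into `H + hb`; this pays for passing to the second branch of the minimum.
      · have hVs := hV' s hs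
        rw [h₀, zero_sub, abs_neg, sub_zero, abs_of_nonneg ha.2.1, abs_of_nonneg hb.2.1] at hVs
        refine (min_le_right _ _).trans (add_le_add ?_ (hreal ?_ hVs))
        · exact hd₁'.trans (add_le_add_left (hle' w xa) _)
        · linarith
    · rw [add_add_add_comm]
      refine (min_le_right _ _).trans (add_le_add hd₁' (hreal ?_ hV))
      linarith [le_abs_self ((hb : ℝ) - ha)]
  · obtain ⟨xa, ea⟩ := hu a (left_mem_Icc.2 hab.le)
    obtain ⟨xb, eb⟩ := hu b (right_mem_Icc.2 hab.le)
    have hsnd' : d₂ xa xb ≤ T := by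
      rcases hsnd with hsnd | ⟨s, hs, h₀⟩
      · simpa only [ea, eb, Glued.base_upper] using hsnd
      · obtain ⟨xs, es⟩ := hu s hs
        rw [es, Glued.height_upper] at h₀
        exact absurd h₀ hH.ne'
    rw [ea, eb, hupper, hupper]
    exact (htri₂ x xa xb).trans (add_le_add_right (hsnd'.trans le_self_add) _)

end

end LowerBounds

/-! ### Definiteness and completeness. -/

section Metric

variable {E : Type*} [NormedAddCommGroup E] [NormedSpace ℝ E]
  {HM : Type*} [TopologicalSpace HM] {I : ModelWithCorners ℝ E HM}
  {M : Type*} [TopologicalSpace M] [ChartedSpace HM M] [IsManifold I ∞ M]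
  [CompactSpace M]
  {t₀ t₁ : ℝ} [Fact (t₀ < t₁)] {H : ℝ} {W : Set (Slab t₀ t₁ M)}
  {g₁ g₂ : SplitMetric I M t₀ t₁} {τ : Slab t₀ t₁ M → ℝ}
  (hτ : MDifferentiable ((𝓡∂ 1).prod I) 𝓘(ℝ, ℝ) τ)
  (hτ₁ : IsTimeFunction g₁.cone τ) (hτ₂ : IsTimeFunction g₂.cone τ)
include hτ hτ₁ hτ₂

theorem gluedDist_pos (hWc : IsClosed W) (hWn : W.Nonempty)
    (hdef : ∀ x y, x ≠ y → 0 < nullDist (jointCone g₁ g₂) τ x y) {z z' : Glued H W}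
    (hz : z ≠ z') : 0 < gluedDist g₁ g₂ τ z z' := by
  have hle := nullDist_joint_add_le_gluedDist hτ hτ₁ hτ₂ z z'
  by_cases hb : z.base = z'.base
  swap
  · exact (hdef _ _ hb).trans_le (le_self_add.trans hle)
  by_cases hh : z.height = z'.height
  swap
  · exact (ENNReal.ofReal_pos.2 (abs_pos.2 (sub_ne_zero.2 hh))).trans_le (le_add_self.trans hle)
  have hnear : ∀ (p : Slab t₀ t₁ M) (ε : ℝ≥0∞), 0 < ε →
      ∀ᶠ q in nhds p, nullDist (jointCone g₁ g₂) τ p q ≤ ε := fun p ε hε =>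
    (eventually_nullDist_le g₁ hτ₁.1 p hε).mono fun q hq =>
      (nullDist_anti (fun _ _ _ => Or.inl) p q).trans hq
  -- The only distinct points with equal base and height are the two copies of a point outside `W`.
  have hsheets : ∀ (x : Slab t₀ t₁ M) (h : Icc 0 H), (h : ℝ) = H →
      Glued.lower W x h ≠ Glued.upper H W x →
      0 < gluedDist g₁ g₂ τ (Glued.lower W x h) (Glued.upper H W x) := by
    intro x h hh hne
    have hx : x ∉ W := fun hx => hne (Glued.lower_eq_upper hx hh)
    exact (iInf_nullDist_pos hnear hWc.isCompact hWn fun w hw =>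
      hdef w x fun e => hx (e ▸ hw)).trans_le (iInf_nullDist_joint_le_gluedDist hτ hτ₁ hτ₂ x x h)
  rcases z.exists_rep with ⟨x, h, rfl⟩ | ⟨x, rfl⟩ <;>
    rcases z'.exists_rep with ⟨x', h', rfl⟩ | ⟨x', rfl⟩ <;>
    simp only [Glued.base_lower, Glued.base_upper, Glued.height_lower, Glued.height_upper] at hb hh
  · exact absurd (by rw [hb, Subtype.ext hh]) hz
  · subst hb
    exact hsheets x h hh hz
  · subst hb
    rw [gluedDist_comm]
    exact hsheets x h' hh.symm hz.symm
  · exact absurd (by rw [hb]) hz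

/-- Completeness follows from compactness: both sheets are continuous images of compact spaces for
the topology of the glued distance. -/
theorem exists_metricSpace_gluedDist [ConnectedSpace M] (hH : 0 < H) (hWc : IsClosed W) (hWn : W.Nonempty)
    (hdef : ∀ x y, x ≠ y → 0 < nullDist (jointCone g₁ g₂) τ x y) :
    ∃ m : MetricSpace (Glued H W), (∀ z z', m.edist z z' = gluedDist g₁ g₂ τ z z') ∧
      @CompleteSpace (Glued H W) m.toUniformSpace := by
  let e : EMetricSpace (Glued H W) :=
    { edist := gluedDist g₁ g₂ τ
      edist_self := gluedDist_self
      edist_comm := gluedDist_comm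
      edist_triangle := gluedDist_triangle
      eq_of_edist_eq_zero := fun {z z'} h => by
        by_contra hne
        exact (gluedDist_pos hτ hτ₁ hτ₂ hWc hWn hdef hne).ne' h }
  have hedist : ∀ z z' : Glued H W, edist z z' = gluedDist g₁ g₂ τ z z' := fun _ _ => rfl
  have hupper : Continuous (Glued.upper H W) := by
    refine continuous_iff_continuousAt.2 fun x => EMetric.tendsto_nhds.2 fun ε hε => ?_
    obtain ⟨ε', h₀, hlt⟩ := exists_between hε
    filter_upwards [eventually_nullDist_le g₂ hτ₁.1 x h₀] with y hy
    rw [edist_comm, hedist]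
    exact ((gluedDist_upper_le hτ hτ₁ hτ₂ hH x y).trans hy).trans_lt hlt
  have hlower : Continuous fun p : Slab t₀ t₁ M × Icc 0 H => Glued.lower W p.1 p.2 := by
    refine continuous_iff_continuousAt.2 fun p => EMetric.tendsto_nhds.2 fun ε hε => ?_
    obtain ⟨ε', h₀, hlt⟩ := exists_between hε
    have hhalf := ENNReal.half_pos h₀.ne'
    have h₁ := continuousAt_fst.eventually (eventually_nullDist_le g₂ hτ₁.1 p.1 hhalf)
    have h₂ : ∀ᶠ q in nhds p, edist q.2 p.2 < ε' / 2 :=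
      EMetric.tendsto_nhds.1 continuousAt_snd _ hhalf
    filter_upwards [h₁, h₂] with q hq₁ hq₂
    rw [edist_comm, hedist]
    refine (gluedDist_lower_le hτ hτ₁ hτ₂ hH p.1 q.1 p.2 q.2).trans_lt (lt_of_le_of_lt ?_ hlt)
    rw [← ENNReal.add_halves ε']
    refine add_le_add hq₁ ?_
    rw [edist_comm, Subtype.edist_eq, edist_dist, Real.dist_eq] at hq₂
    exact hq₂.le
  have hcompact : CompactSpace (Glued H W) := by
    refine ⟨(((isCompact_range hlower).union (isCompact_range hupper)).of_isClosed_subset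
      isClosed_univ fun z _ => ?_)⟩
    rcases z.exists_rep with ⟨x, h, rfl⟩ | ⟨x, rfl⟩
    · exact Or.inl ⟨(x, h), rfl⟩
    · exact Or.inr ⟨x, rfl⟩
  refine ⟨EMetricSpace.toMetricSpace fun z z' =>
    (gluedDist_lt_top hτ hτ₁ hτ₂ hH hWn z z').ne, fun _ _ => rfl, ?_⟩
  exact complete_of_compact

end Metric

end NullGlue

end

theorem mainTheorem5
    {E : Type*} [NormedAddCommGroup E] [NormedSpace ℝ E] [FiniteDimensional ℝ E]
    {HM : Type*} [TopologicalSpace HM] (I : ModelWithCorners ℝ E HM)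
    {M : Type*} [TopologicalSpace M] [ChartedSpace HM M] [IsManifold I ∞ M]
    [T2Space M] [CompactSpace M] [ConnectedSpace M]
    (t₀ t₁ : ℝ) [Fact (t₀ < t₁)]
    (g₁ g₂ : NullGlue.SplitMetric I M t₀ t₁)
    (W : Set (NullGlue.Slab t₀ t₁ M)) (hWc : IsClosed W) (hWn : W.Nonempty)
    (H : ℝ) (hH : 0 < H)
    (τ : NullGlue.Slab t₀ t₁ M → ℝ)
    (hτ : MDifferentiable ((𝓡∂ 1).prod I) 𝓘(ℝ, ℝ) τ)
    (hτ₁ : NullGlue.IsTimeFunction g₁.cone τ) (hτ₂ : NullGlue.IsTimeFunction g₂.cone τ) :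
    ((∀ x y, x ≠ y → 0 < NullGlue.nullDist (NullGlue.jointCone g₁ g₂) τ x y) →
      ∃ m : MetricSpace (NullGlue.Glued H W),
        (∀ z z', m.edist z z' = NullGlue.gluedDist g₁ g₂ τ z z') ∧
        @CompleteSpace (NullGlue.Glued H W) m.toUniformSpace) ∧
    (∀ (x x' : NullGlue.Slab t₀ t₁ M) (h h' : Set.Icc 0 H),
      NullGlue.gluedDist g₁ g₂ τ (NullGlue.Glued.lower W x h) (NullGlue.Glued.lower W x' h') ≤
        NullGlue.nullDist g₂.cone τ x x' + ENNReal.ofReal |(h : ℝ) - h'|) ∧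
    ((∀ (p : NullGlue.Slab t₀ t₁ M) (v : TangentSpace I p.2),
        g₁.spatial p v v / (g₁.lapse p) ^ 2 ≤ g₂.spatial p v v / (g₂.lapse p) ^ 2) →
      (∀ (x x' : NullGlue.Slab t₀ t₁ M) (h h' : Set.Icc 0 H),
        NullGlue.nullDist g₁.cone τ x x' + ENNReal.ofReal |(h : ℝ) - h'| ≤
          NullGlue.gluedDist g₁ g₂ τ
            (NullGlue.Glued.lower W x h) (NullGlue.Glued.lower W x' h')) ∧
      ∀ δ : ℝ, 0 < δ → δ ≤ H →
        (∀ x ∈ W, ∀ y ∈ W, NullGlue.nullDist g₂.cone τ x y ≤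
          NullGlue.nullDist g₁.cone τ x y + ENNReal.ofReal (2 * δ)) →
        (∀ x y, NullGlue.gluedDist g₁ g₂ τ
            (NullGlue.Glued.phi₁ hH.le W x) (NullGlue.Glued.phi₁ hH.le W y) =
          NullGlue.nullDist g₁.cone τ x y) ∧
        (∀ x y, NullGlue.gluedDist g₁ g₂ τ
            (NullGlue.Glued.phi₂ hH.le W x) (NullGlue.Glued.phi₂ hH.le W y) =
          NullGlue.nullDist g₂.cone τ x y)) := by

  refine ⟨NullGlue.exists_metricSpace_gluedDist hτ hτ₁ hτ₂ hH hWc hWn,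
    NullGlue.gluedDist_lower_le hτ hτ₁ hτ₂ hH, fun hcmp => ?_⟩
  have hcone := NullGlue.cone_le_of_comparison hcmp
  have hjoint : ∀ p q, NullGlue.nullDist g₁.cone τ p q ≤
      NullGlue.nullDist (NullGlue.jointCone g₁ g₂) τ p q := fun p q =>
    NullGlue.nullDist_anti (fun p r v h => h.elim id (hcone p r v)) p q
  have hlower : ∀ z z' : NullGlue.Glued H W, NullGlue.nullDist g₁.cone τ z.base z'.base +
      ENNReal.ofReal |z.height - z'.height| ≤ NullGlue.gluedDist g₁ g₂ τ z z' := fun z z' =>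
    (add_le_add_left (hjoint _ _) _).trans
      (NullGlue.nullDist_joint_add_le_gluedDist hτ hτ₁ hτ₂ z z')
  refine ⟨fun x x' h h' =>
    hlower (NullGlue.Glued.lower W x h) (NullGlue.Glued.lower W x' h'),
    fun δ _ hδH hW => ⟨fun x y => ?_, fun x y => ?_⟩⟩
  · exact le_antisymm (NullGlue.gluedDist_bottom_le hτ hτ₁ hτ₂ x y rfl)
      (le_self_add.trans
        (hlower (NullGlue.Glued.phi₁ hH.le W x) (NullGlue.Glued.phi₁ hH.le W y)))
  · rw [NullGlue.Glued.phi₂_eq_upper, NullGlue.Glued.phi₂_eq_upper]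
    -- The lower bound allows a defect `2 * H` on `W`, and `2 * δ ≤ 2 * H`.
    refine le_antisymm (NullGlue.gluedDist_upper_le hτ hτ₁ hτ₂ hH x y) ?_
    refine NullGlue.nullDist_snd_le_gluedDist_upper hτ hτ₁ hτ₂ hH hjoint
      (NullGlue.nullDist_anti hcone) (fun x hx y hy => (hW x hx y hy).trans ?_) x y
    gcongr
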